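/- All graphs are finite. A \emph{$2$-fold cover} of a simple graph $G$ is a pair $(L,H)$, where $H$ is a graph and $L$ assigns to every $u\in V(G)$ a two-element set $L(u)=\{p(u),r(u)\}\subseteq V(H)$ (with $p(u)$ called \emph{poor} and $r(u)$ called \emph{rich}), such that: the sets $L(u)$, $u\in V(G)$, partition $V(H)$; each $H[L(u)]$ is complete; if $H$ has an edge between $L(u)$ and $L(v)$, then $u=v$ or $uv\in E(G)$; and for every $uv\in E(G)$ the edges of $H$ between $L(u)$ and $L(v)$ form a (possibly empty) matching. The graph $G$ is \emph{$(i,j)$-defective-DP-colorable} if for every $2$-fold cover $(L,H)$ of $G$ there is an injective map $\phi:V(G)\to V(H)$ with $\phi(v)\in L(v)$ for all $v$ such that, in the subgraph of $H$ induced by $\phi(V(G))$, every poor vertex has degree at most $i$ and every rich vertex has degree at most $j$. Let $i\ge 3$ and $j\ge 2i+1$ be integers. (1) If $G$ is a simple graph such that every subgraph $H$ of $G$ satisfies $$|E(H)| < \frac{(2i+1)|V(H)|+j-i+1}{i+1},$$ then $G$ is $(i,j)$-defective-DP-colorable. (2) This is sharp: for infinitely many $n$ there is a simple graph $G$ on $n$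 vertices that is not $(i,j)$-defective-DP-colorable, satisfies $$|E(G)| = \frac{(2i+1)n+j-i+1}{i+1},$$ and has the property that every proper subgraph $H$ of $G$ satisfies the strict inequality in (1). -/

import Mathlib

universe u w

/-- A (DP-)cover `(L, H)` of a simple graph `G`, with cover graph `H` on the vertex set `W`. -/
structure DPCover {V : Type u} (G : SimpleGraph V) (W : Type w) where
  /-- the lists -/
  L : V → Set W
  /-- the cover graph -/
  H : SimpleGraph W
  /-- every vertex of the cover graph lies in exactly one list -/
  partition : ∀ x : W, ∃! u : V, x ∈ L u
  /-- every list is a clique of the cover graph -/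
  complete : ∀ u : V, H.IsClique (L u)
  /-- an edge of the cover graph joins two vertices of one list, or of the lists of two
  adjacent vertices of `G` -/
  eq_or_adj : ∀ (u v : V) (x y : W), x ∈ L u → y ∈ L v → H.Adj x y → u = v ∨ G.Adj u v
  /-- the edges between the lists of two adjacent vertices form a (possibly empty, not
  necessarily perfect) matching: a vertex of one list has at most one neighbour in the other
  (and, exchanging `u` and `v`, conversely) -/
  matching : ∀ u v : V, G.Adj u v → ∀ x ∈ L u, ∀ y ∈ L v, ∀ y' ∈ L v,
    H.Adj x y → H.Adj x y' → y = y'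

namespace DPCover

variable {V : Type u} {G : SimpleGraph V} {W : Type w}

/-- The cover is `k`-fold: every list has exactly `k` elements. -/
def IsFold (C : DPCover G W) (k : ℕ) : Prop :=
  ∀ u : V, (C.L u).encard = k

/-- `p u` and `r u` are the poor and the rich vertex of the list of `u`: `L u = {p u, r u}`,
with `p u ≠ r u`. -/
def IsPoorRich (C : DPCover G W) (p r : V → W) : Prop :=
  ∀ u : V, p u ≠ r u ∧ C.L u = {p u, r u}

/-- An `(L, H)`-map chooses, injectively, an element of every list. -/
def IsMap (C : DPCover G W) (φ : V → W) : Prop :=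
  Function.Injective φ ∧ ∀ v : V, φ v ∈ C.L v

/-- The subgraph of the cover graph that is induced by the image of `φ`. -/
def inducedCoverGraph (C : DPCover G W) (φ : V → W) : SimpleGraph (Set.range φ) :=
  C.H.induce (Set.range φ)

/-- An `(i, j)`-defective colouring: in the `φ`-induced cover graph every poor vertex has degree
at most `i` and every rich vertex has degree at most `j`. -/
def IsDefectiveColoring (C : DPCover G W) (p r : V → W) (i j : ℕ) (φ : V → W) : Prop :=
  C.IsMap φ ∧
    (∀ (x : Set.range φ) (u : V), (x : W) = p u →
      ((C.inducedCoverGraph φ).neighborSet x).encard ≤ i) ∧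
    (∀ (x : Set.range φ) (u : V), (x : W) = r u →
      ((C.inducedCoverGraph φ).neighborSet x).encard ≤ j)

end DPCover

/-- `G` is `(i, j)`-defective-DP-colorable: every `2`-fold cover, whichever element of each list is
designated as poor and which one as rich, has an `(i, j)`-defective colouring. -/
def IsDefectiveDPColorable {V : Type u} (G : SimpleGraph V) (i j : ℕ) : Prop :=
  ∀ (W : Type u) (C : DPCover G W) (p r : V → W), C.IsFold 2 → C.IsPoorRich p r →
    ∃ φ : V → W, C.IsDefectiveColoring p r i j φ

/-!
The first part follows from a statement about a wider class of colouring problems, closed under the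
reductions needed for an induction: `FlexSystem`. Its vertices have individual capacities, its hard
edges are the edges of the graph, and its flexible edges, which load only one end, replace the
vertices of degree two. The potential of a vertex set is the sum of its vertex values minus
`i + 1` for each hard and `1` for each flexible edge; `surplus` is the potential shifted so that the
hypothesis on `G` says that no set has negative surplus, and `FlexSystem.Good.colorable` says
that then a colouring exists.

In a counterexample with the fewest vertices, a proper subset of surplus `0` with at least two
elements could be coloured and contracted to a vertex with a forced colour and no capacity left
(`Good.one_le_surplus`); so such tight sets are single vertices. A vertex can be deleted after
fixing its colour, at the cost of one unit of capacity for each hard edge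
(`Good.sum_le_surplus`) and for some of the flexible edges; which of the flexible edges are
charged to the other end is a matter of a submodular bound (`exists_maximal_demand`). If the
deletion fails for a vertex of small hard degree, a set around it with small surplus can
be contracted (`Good.degree_of_adj_tight`, `Good.degree_of_not_adj_tight`). Hence hard degrees are
large compared with capacities, and summing the contributions of all vertices makes the total
surplus negative.

For sharpness, the graph `SharpGraph.graph` consists of a hub and `i + j + 2` gadgets of arbitrary
size. In the cover, `j + 1` of the gadgets load the hub if it is rich and the other `i + 1` if it is
poor (`SharpGraph.exists_conflict`). A gadget adds `-1` to the potential, and each proper part of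
it adds at least `0` (`SharpGraph.neg_one_le_balance`), so the graph is just below the threshold
and its proper subgraphs are not.
-/

/-! ### Systems with capacities, hard edges and flexible edges -/

/-- A colouring problem with capacities on the vertex set `V`. Every vertex receives the colour
`false` (poor) or `true` (rich), and `cap v b` bounds the load of `v` when it has colour `b`;
capacity `-1` forbids the colour. An edge of sign `s` is in conflict if the colours of its ends
have exclusive or `s`: this encodes a perfect matching between two lists. `hard u v s` is the
number of hard edges of sign `s` between `u` and `v`; a hard edge in conflict loads both of its
ends. `flex u v s` is the number of flexible edges; a flexible edge in conflict loads only one of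
its ends, which may be chosen. A flexible edge stands for a path of length two whose inner vertex
has full capacities and no other neighbours: that vertex can always avoid one of the two ends.
The numbers `i` and `j` are the largest poor and rich capacities; they are parameters of the type
because the potential of a vertex depends on them. -/
structure FlexSystem (V : Type*) (i j : ℤ) where
  cap : V → Bool → ℤ
  hard : V → V → Bool → ℤ
  flex : V → V → Bool → ℤ
  hard_nonneg : ∀ u v b, 0 ≤ hard u v b
  flex_nonneg : ∀ u v b, 0 ≤ flex u v b
  hard_symm : ∀ u v b, hard u v b = hard v u b
  flex_symm : ∀ u v b, flex u v b = flex v u b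
  hard_self : ∀ u b, hard u u b = 0
  flex_self : ∀ u b, flex u u b = 0

section HalfSum

variable {V : Type*}

/-- Half of the sum of `s` over `A × A`: the total weight of the edges inside `A` if `s` is
symmetric with zero diagonal. -/
def halfSum (s : V → V → ℤ) (A : Finset V) : ℤ := (∑ u ∈ A, ∑ v ∈ A, s u v) / 2

theorem two_mul_halfSum [DecidableEq V] {s : V → V → ℤ} (hs : ∀ u v, s u v = s v u) (h0 : ∀ u, s u u = 0)
    (A : Finset V) : 2 * halfSum s A = ∑ u ∈ A, ∑ v ∈ A, s u v := by
  apply Int.mul_ediv_cancel'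
  induction A using Finset.induction_on with
  | empty => simp
  | insert a A ha ih =>
    simp only [Finset.sum_insert ha, Finset.sum_add_distrib, h0]
    rw [Finset.sum_congr rfl fun u _ => hs u a]
    obtain ⟨m, hm⟩ := ih
    exact ⟨∑ v ∈ A, s a v + m, by rw [hm]; ring⟩

end HalfSum

namespace FlexSystem

variable {V : Type*} {i j : ℤ}

/-- The number of hard edges between `u` and `v`, of either sign. -/
def hardDeg (D : FlexSystem V i j) (u v : V) : ℤ := D.hard u v false + D.hard u v true

/-- The number of flexible edges between `u` and `v`, of either sign. -/
def flexDeg (D : FlexSystem V i j) (u v : V) : ℤ := D.flex u v false + D.flex u v true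

/-- The cost of the edges between `u` and `v`: `i + 1` for a hard edge, `1` for a flexible edge. -/
def wt (D : FlexSystem V i j) (u v : V) : ℤ := (i + 1) * D.hardDeg u v + D.flexDeg u v

/-- The contribution of a vertex to the potential. It is `2 * i + 1` for full capacities, and each
lost unit of capacity lowers it by one. -/
def value (D : FlexSystem V i j) (v : V) : ℤ := D.cap v false + D.cap v true + 1 + i - j

/-- The potential of `A`, that is, its vertex values minus its edge costs, shifted by `j - i` so that
the critical threshold is `0`. -/
def surplus (D : FlexSystem V i j) (A : Finset V) : ℤ :=
  ∑ v ∈ A, D.value v - halfSum D.wt A + (j - i)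

/-- The load of `u` in `S` under the colouring `φ`; here `o u v` is the number of flexible edges
between `u` and `v` whose conflict is charged to `u`. -/
def load (D : FlexSystem V i j) (S : Finset V) (φ : V → Bool) (o : V → V → ℤ) (u : V) : ℤ :=
  ∑ v ∈ S, (D.hard u v (φ u ^^ φ v) + o u v)

/-- `φ` colours `S`, with the conflicts of the flexible edges charged to their ends according to `o`.
The charges may exceed the number of conflicts. -/
structure IsColoring (D : FlexSystem V i j) (S : Finset V) (φ : V → Bool) (o : V → V → ℤ) :
    Prop where
  nonneg : ∀ u v, 0 ≤ o u v
  flex_le : ∀ u ∈ S, ∀ v ∈ S, D.flex u v (φ u ^^ φ v) ≤ o u v + o v u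
  load_le : ∀ u ∈ S, D.load S φ o u ≤ D.cap u (φ u)

/-- The vertices in `S` can be coloured within their capacities. -/
def Colorable (D : FlexSystem V i j) (S : Finset V) : Prop := ∃ φ o, D.IsColoring S φ o

/-- The capacities lie in the admissible ranges, hard edges inside `S` are simple, and no subset of
`S` has negative surplus. -/
structure Good (D : FlexSystem V i j) (S : Finset V) : Prop where
  neg_one_le : ∀ v ∈ S, ∀ b, -1 ≤ D.cap v b
  poor_le : ∀ v ∈ S, D.cap v false ≤ i
  rich_le : ∀ v ∈ S, D.cap v true ≤ j
  hardDeg_le : ∀ u ∈ S, ∀ v ∈ S, D.hardDeg u v ≤ 1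
  surplus_nonneg : ∀ A ⊆ S, 0 ≤ D.surplus A

variable (D : FlexSystem V i j)

theorem hardDeg_nonneg (u v : V) : 0 ≤ D.hardDeg u v :=
  add_nonneg (D.hard_nonneg _ _ _) (D.hard_nonneg _ _ _)

theorem flexDeg_nonneg (u v : V) : 0 ≤ D.flexDeg u v :=
  add_nonneg (D.flex_nonneg _ _ _) (D.flex_nonneg _ _ _)

theorem hardDeg_comm (u v : V) : D.hardDeg u v = D.hardDeg v u := by
  simp only [hardDeg, D.hard_symm u v]

theorem flexDeg_comm (u v : V) : D.flexDeg u v = D.flexDeg v u := by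
  simp only [flexDeg, D.flex_symm u v]

theorem hardDeg_self (u : V) : D.hardDeg u u = 0 := by simp [hardDeg, D.hard_self]

theorem flexDeg_self (u : V) : D.flexDeg u u = 0 := by simp [flexDeg, D.flex_self]

theorem hard_le_hardDeg (u v : V) (b : Bool) : D.hard u v b ≤ D.hardDeg u v := by
  have h0 := D.hard_nonneg u v false
  have h1 := D.hard_nonneg u v true
  cases b <;> simp only [hardDeg] <;> linarith

theorem wt_comm (u v : V) : D.wt u v = D.wt v u := by
  simp only [wt, D.hardDeg_comm u v, D.flexDeg_comm u v]

theorem wt_self (u : V) : D.wt u u = 0 := by simp [wt, hardDeg_self, flexDeg_self]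

theorem wt_nonneg (hi : 0 ≤ i) (u v : V) : 0 ≤ D.wt u v :=
  add_nonneg (mul_nonneg (by linarith) (D.hardDeg_nonneg u v)) (D.flexDeg_nonneg u v)

theorem sum_wt (v : V) (A : Finset V) :
    ∑ u ∈ A, D.wt v u = (i + 1) * ∑ u ∈ A, D.hardDeg v u + ∑ u ∈ A, D.flexDeg v u := by
  simp only [wt, Finset.sum_add_distrib, Finset.mul_sum]

theorem sum_wt_comm (D : FlexSystem V i j) (T : Finset V) (w : V) :
    ∑ y ∈ T, D.wt y w = (i + 1) * ∑ y ∈ T, D.hardDeg y w + ∑ y ∈ T, D.flexDeg y w := by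
  simp only [wt, Finset.sum_add_distrib, Finset.mul_sum]

theorem surplus_singleton (v : V) : D.surplus {v} = D.value v + (j - i) := by
  simp [surplus, halfSum, wt_self]

@[simp] theorem surplus_empty : D.surplus ∅ = j - i := by simp [surplus, halfSum]

variable {D}

theorem Good.mono {S T : Finset V} (h : D.Good S) (hT : T ⊆ S) : D.Good T where
  neg_one_le v hv := h.neg_one_le v (hT hv)
  poor_le v hv := h.poor_le v (hT hv)
  rich_le v hv := h.rich_le v (hT hv)
  hardDeg_le u hu v hv := h.hardDeg_le u (hT hu) v (hT hv)
  surplus_nonneg A hA := h.surplus_nonneg A (hA.trans hT)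

theorem Good.value_le {S : Finset V} (h : D.Good S) {v : V} (hv : v ∈ S) :
    D.value v ≤ 2 * i + 1 := by
  have := h.poor_le v hv
  have := h.rich_le v hv
  simp only [value]; linarith

theorem load_nonneg {S : Finset V} {φ : V → Bool} {o : V → V → ℤ} (h : ∀ u v, 0 ≤ o u v)
    (u : V) : 0 ≤ D.load S φ o u :=
  Finset.sum_nonneg fun v _ => add_nonneg (D.hard_nonneg _ _ _) (h u v)

variable [DecidableEq V] (D)

theorem two_mul_surplus (A : Finset V) :
    2 * D.surplus A = 2 * (j - i) + ∑ v ∈ A, (2 * D.value v - ∑ u ∈ A, D.wt v u) := by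
  rw [surplus, mul_add, mul_sub, two_mul_halfSum D.wt_comm D.wt_self, Finset.sum_sub_distrib,
    Finset.mul_sum]
  ring

theorem surplus_union {A B : Finset V} (h : Disjoint A B) :
    D.surplus (A ∪ B) =
      D.surplus A + D.surplus B - (j - i) - ∑ a ∈ A, ∑ b ∈ B, D.wt a b := by
  have h1 := D.two_mul_surplus (A ∪ B)
  have hA := D.two_mul_surplus A
  have hB := D.two_mul_surplus B
  simp only [Finset.sum_union h, Finset.sum_sub_distrib, Finset.sum_add_distrib] at h1 hA hB
  have hc : ∑ b ∈ B, ∑ a ∈ A, D.wt b a = ∑ a ∈ A, ∑ b ∈ B, D.wt a b := by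
    rw [Finset.sum_comm]
    simp only [D.wt_comm]
  linarith

theorem surplus_insert {v : V} {A : Finset V} (h : v ∉ A) :
    D.surplus (insert v A) = D.surplus A + D.value v - ∑ u ∈ A, D.wt v u := by
  have := D.surplus_union (A := {v}) (B := A) (by simpa using h)
  rw [Finset.singleton_union] at this
  rw [this, surplus_singleton, Finset.sum_singleton]
  ring

theorem surplus_union_add_inter_le (hi : 0 ≤ i) (A B : Finset V) :
    D.surplus (A ∪ B) + D.surplus (A ∩ B) ≤ D.surplus A + D.surplus B := by
  have h1 := D.surplus_union (A := A) (B := B \ A) Finset.disjoint_sdiff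
  have h2 := D.surplus_union (A := A ∩ B) (B := B \ A)
    (Finset.disjoint_sdiff.mono_left Finset.inter_subset_left)
  have e1 : A ∪ B \ A = A ∪ B := by simp
  have e2 : A ∩ B ∪ B \ A = B := by
    ext x; simp only [Finset.mem_union, Finset.mem_inter, Finset.mem_sdiff]; tauto
  rw [e1] at h1
  rw [e2] at h2
  have h3 : ∑ a ∈ A ∩ B, ∑ b ∈ B \ A, D.wt a b ≤ ∑ a ∈ A, ∑ b ∈ B \ A, D.wt a b :=
    Finset.sum_le_sum_of_subset_of_nonneg Finset.inter_subset_left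
      fun a _ _ => Finset.sum_nonneg fun b _ => D.wt_nonneg hi a b
  linarith

end FlexSystem

/-! ### Distributing demands under a submodular bound -/

/-- Every `u` has a demand `F u`, of which it can take over a part `k u`, subject to a submodular
bound `h` on the amount taken over by a set. If each set can cover its demand up to `q`, the
uncovered demand of a suitable `k` is at most `q` altogether. This is the rank formula of the
polymatroid defined by `h`. -/
theorem exists_maximal_demand {V : Type*} [DecidableEq V] (R : Finset V) (h : Finset V → ℤ)
    (F : V → ℤ) (q : ℤ) (hq : 0 ≤ q) (hF : ∀ u, 0 ≤ F u)
    (hsub : ∀ A B, h (A ∪ B) + h (A ∩ B) ≤ h A + h B) (h0 : ∀ A ⊆ R, 0 ≤ h A)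
    (h1 : ∀ A ⊆ R, ∑ u ∈ A, F u - q ≤ h A) :
    ∃ k : V → ℤ, (∀ u, 0 ≤ k u ∧ k u ≤ F u) ∧ (∀ A ⊆ R, ∑ u ∈ A, k u ≤ h A) ∧
      ∑ u ∈ R, (F u - k u) ≤ q := by
  suffices H : ∀ n : ℕ, ∀ k : V → ℤ, (∀ u, 0 ≤ k u ∧ k u ≤ F u) →
      (∀ A ⊆ R, ∑ u ∈ A, k u ≤ h A) → ∑ u ∈ R, (F u - k u) ≤ q + n →
      ∃ k : V → ℤ, (∀ u, 0 ≤ k u ∧ k u ≤ F u) ∧ (∀ A ⊆ R, ∑ u ∈ A, k u ≤ h A) ∧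
        ∑ u ∈ R, (F u - k u) ≤ q by
    refine H (∑ u ∈ R, F u).toNat (fun _ => 0) (fun u => ⟨le_rfl, hF u⟩)
      (fun A hA => by simpa using h0 A hA) ?_
    have := Int.self_le_toNat (∑ u ∈ R, F u)
    simp only [sub_zero]
    linarith
  intro n
  induction n with
  | zero => intro k h1 h2 h3; exact ⟨k, h1, h2, by simpa using h3⟩
  | succ n ih =>
    intro k hk hkA hks
    by_cases hz : ∃ z ∈ R, k z < F z ∧ ∀ A ⊆ R, z ∈ A → ∑ u ∈ A, k u < h A
    · obtain ⟨z, hzR, hzF, hzA⟩ := hz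
      refine ih (fun u => k u + if u = z then 1 else 0) (fun u => ?_) (fun A hA => ?_) ?_
      · have := hk u
        split_ifs with huz
        · subst huz; constructor <;> linarith
        · simpa using this
      · rw [Finset.sum_add_distrib, Finset.sum_ite_eq']
        split_ifs with hzA'
        · exact hzA A hA hzA'
        · simpa using hkA A hA
      · have : ∑ u ∈ R, (F u - (k u + if u = z then 1 else 0)) =
            ∑ u ∈ R, (F u - k u) - 1 := by
          simp only [← sub_sub, Finset.sum_sub_distrib, Finset.sum_ite_eq', hzR, if_true]
        rw [this]
        push_cast at hks
        linarith
    · push Not at hz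
      refine ⟨k, hk, hkA, ?_⟩
      by_cases hd : ∃ z ∈ R, k z < F z
      · obtain ⟨z, hzR, hzF⟩ := hd
        obtain ⟨A₀, hA₀, -, hA₀'⟩ := hz z hzR hzF
        -- a largest tight set contains every tight set, as tight sets are closed under union
        obtain ⟨A, hA, hmax⟩ := Finset.exists_max_image
          (R.powerset.filter fun A => h A ≤ ∑ u ∈ A, k u) Finset.card
          ⟨A₀, by simpa using ⟨hA₀, hA₀'⟩⟩
        simp only [Finset.mem_filter, Finset.mem_powerset] at hA hmax
        have hcov : ∀ z ∈ R, z ∉ A → F z - k z = 0 := by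
          intro z hzR hzA
          by_contra hne
          have hlt : k z < F z := lt_of_le_of_ne (hk z).2 fun h => hne (by rw [h]; ring)
          obtain ⟨B, hB, hzB, hBt⟩ := hz z hzR hlt
          have hU := hmax (A ∪ B) ⟨Finset.union_subset hA.1 hB, by
            have e := Finset.sum_union_inter (s₁ := A) (s₂ := B) (f := k)
            have := hsub A B
            have := hkA (A ∩ B) (Finset.inter_subset_left.trans hA.1)
            linarith [hA.2]⟩
          have := Finset.eq_of_subset_of_card_le Finset.subset_union_left hU
          exact hzA (this ▸ Finset.mem_union_right _ hzB)
        rw [← Finset.sum_subset hA.1 hcov, Finset.sum_sub_distrib]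
        have := h1 A hA.1
        linarith [hA.2]
      · push Not at hd
        rw [Finset.sum_eq_zero fun z hz => by have := hd z hz; have := (hk z).2; linarith]
        exact hq

/-! ### Deleting a vertex -/

namespace FlexSystem

variable {V : Type*} {i j : ℤ}

/-- The same edges with other capacities. -/
def withCap (D : FlexSystem V i j) (c : V → Bool → ℤ) : FlexSystem V i j := { D with cap := c }

theorem surplus_withCap (D : FlexSystem V i j) (c : V → Bool → ℤ) (A : Finset V) :
    (D.withCap c).surplus A =
      D.surplus A + ∑ v ∈ A, ((D.withCap c).value v - D.value v) := by
  rw [Finset.sum_sub_distrib, surplus, surplus]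
  have : halfSum (D.withCap c).wt A = halfSum D.wt A := rfl
  rw [this]; ring

variable [DecidableEq V] {D : FlexSystem V i j}

/-- A vertex `v` is given the colour `a` in advance and deleted. Each neighbour `u` loses `e u` units
of capacity for the hard edges to `v`, and further units for those flexible edges to `v` that are
charged to `u`; the other flexible edges are charged to `v`. The function `e` may vanish at
neighbours whose only available colour does not conflict with `a`. If the surplus of every set
pays for these losses, the deleted system is colourable, and `v` keeps `slack` units of its
capacity. -/
theorem exists_isColoring_of_erase {T : Finset V} {v : V} (hi : 0 ≤ i) (hT : D.Good T)
    (hv : v ∈ T) (a : Bool) (e : V → ℤ) {slack : ℤ} (hs : 0 ≤ slack)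
    (IH : ∀ D' : FlexSystem V i j, D'.Good (T.erase v) → D'.Colorable (T.erase v))
    (he0 : ∀ u, 0 ≤ e u)
    (he : ∀ u ∈ T.erase v,
      D.hardDeg v u ≤ e u ∨ ∀ b, 0 ≤ D.cap u b → D.hard v u (a ^^ b) = 0)
    (hq : ∑ u ∈ T.erase v, e u + slack ≤ D.cap v a)
    (h0 : ∀ A ⊆ T.erase v, ∑ u ∈ A, e u ≤ D.surplus A)
    (h1 : ∀ A ⊆ T.erase v, ∑ u ∈ A, D.flexDeg v u + ∑ u ∈ A, e u +
      ∑ u ∈ T.erase v, e u + slack ≤ D.surplus A + D.cap v a) :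
    ∃ φ o, D.IsColoring T φ o ∧ φ v = a ∧ D.load T φ o v + slack ≤ D.cap v a := by
  obtain ⟨k, hk, hkA, hkq⟩ := exists_maximal_demand (T.erase v)
    (fun A => D.surplus A - ∑ u ∈ A, e u) (D.flexDeg v)
    (D.cap v a - ∑ u ∈ T.erase v, e u - slack) (by linarith) (D.flexDeg_nonneg v)
    (fun A B => by
      have := D.surplus_union_add_inter_le hi A B
      have := Finset.sum_union_inter (s₁ := A) (s₂ := B) (f := e)
      linarith)
    (fun A hA => by have := h0 A hA; linarith)
    (fun A hA => by have := h1 A hA; linarith)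
  -- `kk u b` is the number of flexible edges to `v` charged to `u` when `u` gets the colour `b`
  obtain ⟨kk, hkk0, hkk1, hkk2⟩ : ∃ kk : V → Bool → ℤ, (∀ u b, 0 ≤ kk u b) ∧
      (∀ u b, kk u b ≤ D.flex v u (a ^^ b)) ∧ ∀ u, kk u false + kk u true = k u := by
    refine ⟨fun u b => if b then k u - min (k u) (D.flex v u (a ^^ false)) else
      min (k u) (D.flex v u (a ^^ false)), ?_, ?_, ?_⟩
    · intro u b
      have := (hk u).1
      have := D.flex_nonneg v u (a ^^ false)
      cases b <;> simp_all
    · intro u b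
      have h2 := (hk u).2
      have h3 : D.flexDeg v u = D.flex v u (a ^^ false) + D.flex v u (a ^^ true) := by
        cases a <;> simp [flexDeg, add_comm]
      have h4 := D.flex_nonneg v u (a ^^ true)
      cases b
      · simp
      · simp only [if_true]
        rcases min_cases (k u) (D.flex v u (a ^^ false)) with h | h <;> linarith
    · intro u; simp
  let c : V → Bool → ℤ := fun u b => max (-1) (D.cap u b - D.hard v u (a ^^ b) - kk u b)
  have hval : ∀ u ∈ T.erase v, -(e u) - k u ≤ (D.withCap c).value u - D.value u := by
    intro u hu
    have hc := hT.neg_one_le u (Finset.mem_of_mem_erase hu)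
    have hc0 := hc false
    have hc1 := hc true
    have h2 := hkk2 u
    have h3 := hkk0 u false
    have h4 := hkk0 u true
    have h5 := he0 u
    have key : D.cap u false + D.cap u true - e u - k u ≤ c u false + c u true := by
      rcases he u hu with h | h
      · have h6 : D.hardDeg v u = D.hard v u (a ^^ false) + D.hard v u (a ^^ true) := by
          cases a <;> simp [hardDeg, add_comm]
        have := le_max_right (-1) (D.cap u false - D.hard v u (a ^^ false) - kk u false)
        have := le_max_right (-1) (D.cap u true - D.hard v u (a ^^ true) - kk u true)
        simp only [c]; linarith
      · have hb : ∀ b, D.cap u b - kk u b ≤ c u b := by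
          intro b
          by_cases hb : 0 ≤ D.cap u b
          · have := le_max_right (-1) (D.cap u b - D.hard v u (a ^^ b) - kk u b)
            have := h b hb
            simp only [c]; linarith
          · have := le_max_left (-1) (D.cap u b - D.hard v u (a ^^ b) - kk u b)
            have := hkk0 u b
            simp only [c]; linarith
        have := hb false
        have := hb true
        linarith
    simp only [value, withCap]; linarith
  have hgood : (D.withCap c).Good (T.erase v) := by
    have hcle : ∀ u ∈ T.erase v, ∀ b, c u b ≤ D.cap u b := by
      intro u hu b
      have := hT.neg_one_le u (Finset.mem_of_mem_erase hu) b
      have := D.hard_nonneg v u (a ^^ b)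
      have := hkk0 u b
      exact max_le (by linarith) (by linarith)
    refine ⟨fun u _ b => le_max_left _ _, fun u hu => ?_, fun u hu => ?_, fun u hu w hw => ?_,
      fun A hA => ?_⟩
    · exact (hcle u hu _).trans (hT.poor_le u (Finset.mem_of_mem_erase hu))
    · exact (hcle u hu _).trans (hT.rich_le u (Finset.mem_of_mem_erase hu))
    · exact hT.hardDeg_le u (Finset.mem_of_mem_erase hu) w (Finset.mem_of_mem_erase hw)
    · rw [surplus_withCap]
      have h2 := Finset.sum_le_sum fun u hu => hval u (hA hu)
      rw [Finset.sum_sub_distrib, Finset.sum_neg_distrib] at h2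
      have := hkA A hA
      linarith
  obtain ⟨φ, o, ho⟩ := IH _ hgood
  have hvT : v ∉ T.erase v := Finset.notMem_erase v T
  have hne : ∀ u ∈ T.erase v, u ≠ v := fun u hu => Finset.ne_of_mem_erase hu
  let φ' : V → Bool := Function.update φ v a
  let o' : V → V → ℤ := fun u w =>
    if u = v then (if w = v then 0 else D.flex v w (a ^^ φ w) - kk w (φ w))
    else if w = v then kk u (φ u) else o u w
  have hφv : φ' v = a := by simp [φ']
  have hφ : ∀ u, u ≠ v → φ' u = φ u := fun u hu => by simp [φ', hu]
  have hcap : ∀ u ∈ T.erase v, (D.withCap c).load (T.erase v) φ o u +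
      D.hard v u (a ^^ φ u) + kk u (φ u) ≤ D.cap u (φ u) ∧ 0 ≤ D.cap u (φ u) := by
    intro u hu
    have h2 := ho.load_le u hu
    have h3 : 0 ≤ (D.withCap c).load (T.erase v) φ o u := load_nonneg ho.nonneg u
    have h4 : (D.withCap c).cap u (φ u) =
      max (-1) (D.cap u (φ u) - D.hard v u (a ^^ φ u) - kk u (φ u)) := rfl
    have := D.hard_nonneg v u (a ^^ φ u)
    have := hkk0 u (φ u)
    rcases max_cases (-1) (D.cap u (φ u) - D.hard v u (a ^^ φ u) - kk u (φ u)) with h | h <;>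
      constructor <;> linarith
  have hloadv : D.load T φ' o' v + slack ≤ D.cap v a := by
    have : D.load T φ' o' v = ∑ w ∈ T.erase v,
        (D.hard v w (a ^^ φ w) + (D.flex v w (a ^^ φ w) - kk w (φ w))) := by
      rw [load, ← Finset.add_sum_erase T _ hv, D.hard_self]
      simp only [o', if_true, add_zero, zero_add]
      refine Finset.sum_congr rfl fun w hw => ?_
      rw [hφv, hφ w (hne w hw), if_neg (hne w hw)]
    rw [this]
    have h2 : ∑ w ∈ T.erase v, (D.hard v w (a ^^ φ w) +
        (D.flex v w (a ^^ φ w) - kk w (φ w))) ≤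
        ∑ w ∈ T.erase v, (e w + (D.flexDeg v w - k w)) := by
      refine Finset.sum_le_sum fun w hw => add_le_add ?_ ?_
      · rcases he w hw with h | h
        · exact (D.hard_le_hardDeg _ _ _).trans h
        · rw [h _ (hcap w hw).2]; exact he0 w
      · have h3 := hkk1 w (!(φ w))
        have h4 : D.flexDeg v w = D.flex v w (a ^^ φ w) + D.flex v w (a ^^ !(φ w)) := by
          cases a <;> cases φ w <;> simp [flexDeg, add_comm]
        have h5 : k w = kk w (φ w) + kk w (!(φ w)) := by
          rw [← hkk2 w]; cases φ w <;> simp [add_comm]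
        linarith
    have h3 := h2.trans_eq Finset.sum_add_distrib
    linarith
  refine ⟨φ', o', ⟨fun u w => ?_, fun u hu w hw => ?_, fun u hu => ?_⟩, hφv, hloadv⟩
  · simp only [o']
    split_ifs
    · exact le_rfl
    · have := hkk1 w (φ w); linarith
    · exact hkk0 _ _
    · exact ho.nonneg _ _
  · by_cases huv : u = v
    · subst huv
      by_cases hwv : w = u
      · subst hwv; simp [o', D.flex_self]
      · rw [hφv, hφ w hwv]; simp [o', hwv]
    · by_cases hwv : w = v
      · subst hwv
        rw [hφv, hφ u huv, D.flex_symm, Bool.xor_comm]; simp [o', huv]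
      · rw [hφ u huv, hφ w hwv]
        simp only [o', huv, hwv, if_false]
        exact ho.flex_le u (Finset.mem_erase.2 ⟨huv, hu⟩) w (Finset.mem_erase.2 ⟨hwv, hw⟩)
  · by_cases huv : u = v
    · subst huv; rw [hφv]; linarith
    · have hu' : u ∈ T.erase v := Finset.mem_erase.2 ⟨huv, hu⟩
      rw [hφ u huv]
      refine le_trans (le_of_eq ?_) (hcap u hu').1
      rw [load, ← Finset.add_sum_erase T _ hv, load, hφ u huv, hφv, D.hard_symm u v,
        Bool.xor_comm (φ u) a]
      simp only [o', huv, if_true, if_false]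
      rw [Finset.sum_congr rfl fun w hw => by rw [hφ w (hne w hw), if_neg (hne w hw)]]
      simp only [withCap]
      ring
end FlexSystem

/-! ### Contracting a coloured set -/

namespace FlexSystem

variable {V : Type*} [DecidableEq V] {i j : ℤ}

/-- Given a colouring `φ` of `T`, the set `T` is contracted to its element `v`, which gets capacity
`0` for the colour `true` and `-1` for `false`. Signs are chosen so that the contracted vertex, being
`true`, conflicts with exactly those colours outside `T` that conflict with `φ` on `T`. The
hard edges from `v` to `W` are deleted, and the conflicting colours of `W` lose one unit of
capacity instead. -/
def contract (D : FlexSystem V i j) (T W : Finset V) (v : V) (hv : v ∈ T) (φ : V → Bool) :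
    FlexSystem V i j where
  cap u b := if u = v then (if b then 0 else -1) else
    if u ∈ W then max (-1) (D.cap u b - D.hard v u (φ v ^^ b)) else D.cap u b
  hard u w b :=
    if u = v then
      (if w = v then 0 else
        ∑ y ∈ T, D.hard y w (φ y ^^ !b) - if w ∈ W then D.hard v w (φ v ^^ !b) else 0)
    else if w = v then
      ∑ y ∈ T, D.hard y u (φ y ^^ !b) - if u ∈ W then D.hard v u (φ v ^^ !b) else 0
    else D.hard u w b
  flex u w b :=
    if u = v then (if w = v then 0 else ∑ y ∈ T, D.flex y w (φ y ^^ !b))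
    else if w = v then ∑ y ∈ T, D.flex y u (φ y ^^ !b) else D.flex u w b
  hard_nonneg u w b := by
    have key : ∀ x, 0 ≤ ∑ y ∈ T, D.hard y x (φ y ^^ !b) -
        if x ∈ W then D.hard v x (φ v ^^ !b) else 0 := by
      intro x
      have h1 := Finset.single_le_sum (f := fun y => D.hard y x (φ y ^^ !b))
        (fun y _ => D.hard_nonneg y x _) hv
      have h2 := D.hard_nonneg v x (φ v ^^ !b)
      split_ifs <;> linarith
    by_cases hu : u = v
    · by_cases hw : w = v
      · rw [if_pos hu, if_pos hw]
      · rw [if_pos hu, if_neg hw]; exact key w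
    · by_cases hw : w = v
      · rw [if_neg hu, if_pos hw]; exact key u
      · rw [if_neg hu, if_neg hw]; exact D.hard_nonneg _ _ _
  flex_nonneg u w b := by
    split_ifs
    · exact le_rfl
    · exact Finset.sum_nonneg fun y _ => D.flex_nonneg _ _ _
    · exact Finset.sum_nonneg fun y _ => D.flex_nonneg _ _ _
    · exact D.flex_nonneg _ _ _
  hard_symm u w b := by
    by_cases hu : u = v <;> by_cases hw : w = v <;> simp [hu, hw, D.hard_symm u w]
  flex_symm u w b := by
    by_cases hu : u = v <;> by_cases hw : w = v <;> simp [hu, hw, D.flex_symm u w]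
  hard_self u b := by by_cases hu : u = v <;> simp [hu, D.hard_self]
  flex_self u b := by by_cases hu : u = v <;> simp [hu, D.flex_self]

variable {D : FlexSystem V i j}

section contract

variable {T W : Finset V} {v : V} {hv : v ∈ T} {φ : V → Bool}

/-- Contraction preserves the number of edges to `T`, but for the deleted ones. -/
theorem contract_hardDeg {w : V} (hw : w ≠ v) :
    (D.contract T W v hv φ).hardDeg v w =
      ∑ y ∈ T, D.hardDeg y w - if w ∈ W then D.hardDeg v w else 0 := by
  have h : ∀ y, D.hard y w (φ y) + D.hard y w (!(φ y)) = D.hardDeg y w := by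
    intro y; cases φ y <;> simp [hardDeg, add_comm]
  simp only [← h, Finset.sum_add_distrib]
  simp only [hardDeg, contract, if_true, if_neg hw, Bool.not_false, Bool.not_true,
    Bool.xor_true, Bool.xor_false]
  split_ifs <;> ring

theorem contract_flexDeg {w : V} (hw : w ≠ v) :
    (D.contract T W v hv φ).flexDeg v w = ∑ y ∈ T, D.flexDeg y w := by
  have h : ∀ y, D.flex y w (φ y) + D.flex y w (!(φ y)) = D.flexDeg y w := by
    intro y; cases φ y <;> simp [flexDeg, add_comm]
  simp only [← h, Finset.sum_add_distrib]
  simp only [flexDeg, contract, if_true, if_neg hw, Bool.not_false, Bool.not_true,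
    Bool.xor_true, Bool.xor_false]
  ring

theorem contract_surplus {B : Finset V} (hvB : v ∉ B) :
    D.surplus B - ∑ u ∈ B, (if u ∈ W then D.hardDeg v u else 0) ≤
      (D.contract T W v hv φ).surplus B := by
  have hne : ∀ u ∈ B, u ≠ v := fun u hu h => hvB (h ▸ hu)
  have hwt : ∀ u ∈ B, ∀ w ∈ B, (D.contract T W v hv φ).wt u w = D.wt u w := by
    intro u hu w hw
    simp only [wt, hardDeg, flexDeg, contract, if_neg (hne u hu), if_neg (hne w hw)]
  have h1 : halfSum (D.contract T W v hv φ).wt B = halfSum D.wt B := by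
    simp only [halfSum]
    rw [Finset.sum_congr rfl fun u hu => Finset.sum_congr rfl (hwt u hu)]
  rw [surplus, surplus, h1]
  have h2 : ∑ u ∈ B, (D.value u - if u ∈ W then D.hardDeg v u else 0) ≤
      ∑ u ∈ B, (D.contract T W v hv φ).value u := by
    refine Finset.sum_le_sum fun u hu => ?_
    simp only [value, contract, if_neg (hne u hu)]
    split_ifs with huW
    · have h3 : D.hard v u (φ v ^^ false) + D.hard v u (φ v ^^ true) = D.hardDeg v u := by
        cases φ v <;> simp [hardDeg, add_comm]
      have := le_max_right (-1) (D.cap u false - D.hard v u (φ v ^^ false))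
      have := le_max_right (-1) (D.cap u true - D.hard v u (φ v ^^ true))
      linarith
    · linarith
  rw [Finset.sum_sub_distrib] at h2
  linarith

/-- The contracted vertex bears no load, so a colouring of the contraction extends that of `T`
without new conflicts at `T`, except for the edges from `v` to `W`, for which `v` has `k` units to
spare. -/
theorem colorable_of_contract {S : Finset V} {o : V → V → ℤ} {k : ℤ} (hTS : T ⊆ S)
    (hWT : ∀ w ∈ W, w ∈ S \ T)
    (ho : D.IsColoring T φ o) (hk : D.load T φ o v + k ≤ D.cap v (φ v))
    (hWk : ∑ w ∈ W, D.hardDeg v w ≤ k)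
    (hcol : (D.contract T W v hv φ).Colorable (insert v (S \ T))) : D.Colorable S := by
  obtain ⟨φ₁, o₁, h₁⟩ := hcol
  set D' := D.contract T W v hv φ with hD'
  have hvR : v ∉ S \ T := fun h => (Finset.mem_sdiff.1 h).2 hv
  have hne : ∀ u ∈ S \ T, u ≠ v := fun u hu h => hvR (h ▸ hu)
  have hload := h₁.load_le v (Finset.mem_insert_self _ _)
  have hload0 : 0 ≤ D'.load (insert v (S \ T)) φ₁ o₁ v := load_nonneg h₁.nonneg v
  have hvc : D'.cap v (φ₁ v) = if φ₁ v then 0 else -1 := by simp [hD', contract]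
  have hφv : φ₁ v = true := by
    by_contra h
    rw [hvc, if_neg h] at hload
    linarith
  rw [hvc, hφv, if_pos rfl] at hload
  -- nothing loads the contracted vertex
  have hzero : ∀ u ∈ S \ T, D'.hard v u (!(φ₁ u)) = 0 ∧ o₁ v u = 0 := by
    intro u hu
    have h2 : D'.load (insert v (S \ T)) φ₁ o₁ v = 0 := le_antisymm hload hload0
    have h3 := (Finset.sum_eq_zero_iff_of_nonneg fun w _ =>
      add_nonneg (D'.hard_nonneg v w _) (h₁.nonneg v w)).1 h2 u (Finset.mem_insert_of_mem hu)
    have h4 := D'.hard_nonneg v u (φ₁ v ^^ φ₁ u)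
    have h5 := h₁.nonneg v u
    rw [hφv, Bool.true_xor] at h3 h4
    constructor <;> linarith
  have hhard : ∀ u ∈ S \ T, ∑ y ∈ T, D.hard y u (φ y ^^ φ₁ u) =
      if u ∈ W then D.hard v u (φ v ^^ φ₁ u) else 0 := by
    intro u hu
    have h2 := (hzero u hu).1
    simp only [hD', contract, if_true, if_neg (hne u hu), Bool.not_not] at h2
    linarith
  have hflex : ∀ u ∈ S \ T, ∑ y ∈ T, D.flex y u (φ y ^^ φ₁ u) ≤ o₁ u v := by
    intro u hu
    have h2 := h₁.flex_le v (Finset.mem_insert_self _ _) u (Finset.mem_insert_of_mem hu)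
    rw [(hzero u hu).2, hφv] at h2
    simpa only [hD', contract, if_true, if_neg (hne u hu), Bool.true_xor, Bool.not_not,
      zero_add] using h2
  let Φ : V → Bool := fun u => if u ∈ T then φ u else φ₁ u
  let O : V → V → ℤ := fun u w =>
    if u ∈ T then (if w ∈ T then o u w else 0)
    else if w ∈ T then D.flex u w (Φ u ^^ Φ w) else o₁ u w
  have hΦT : ∀ u ∈ T, Φ u = φ u := fun u hu => if_pos hu
  have hΦR : ∀ u ∈ S \ T, Φ u = φ₁ u := fun u hu => if_neg (Finset.mem_sdiff.1 hu).2
  refine ⟨Φ, O, ⟨fun u w => ?_, fun u hu w hw => ?_, fun u hu => ?_⟩⟩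
  · simp only [O]
    split_ifs
    · exact ho.nonneg _ _
    · exact le_rfl
    · exact D.flex_nonneg _ _ _
    · exact h₁.nonneg _ _
  · by_cases huT : u ∈ T <;> by_cases hwT : w ∈ T
    · simp only [O, huT, hwT, if_true, hΦT u huT, hΦT w hwT]
      exact ho.flex_le u huT w hwT
    · simp only [O, huT, hwT, if_true, if_false]
      rw [D.flex_symm, Bool.xor_comm]; simp
    · simp [O, huT, hwT]
    · have hu' := Finset.mem_sdiff.2 ⟨hu, huT⟩
      have hw' := Finset.mem_sdiff.2 ⟨hw, hwT⟩
      have h2 := h₁.flex_le u (Finset.mem_insert_of_mem hu') w (Finset.mem_insert_of_mem hw')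
      simp only [O, huT, hwT, if_false, hΦR u hu', hΦR w hw']
      simpa only [hD', contract, if_neg (hne u hu'), if_neg (hne w hw')] using h2
  · have hsplit : D.load S Φ O u = ∑ w ∈ S \ T, (D.hard u w (Φ u ^^ Φ w) + O u w) +
        ∑ w ∈ T, (D.hard u w (Φ u ^^ Φ w) + O u w) :=
      (Finset.sum_sdiff hTS).symm
    rw [hsplit]
    by_cases huT : u ∈ T
    · have e1 : ∑ w ∈ T, (D.hard u w (Φ u ^^ Φ w) + O u w) = D.load T φ o u := by
        refine Finset.sum_congr rfl fun w hw => ?_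
        simp only [O, huT, hw, if_true, hΦT u huT, hΦT w hw]
      have e2 : ∑ w ∈ S \ T, (D.hard u w (Φ u ^^ Φ w) + O u w) =
          ∑ w ∈ S \ T, D.hard u w (φ u ^^ φ₁ w) := by
        refine Finset.sum_congr rfl fun w hw => ?_
        simp only [O, huT, (Finset.mem_sdiff.1 hw).2, if_true, if_false, hΦT u huT, hΦR w hw,
          add_zero]
      rw [e1, e2, hΦT u huT]
      by_cases huv : u = v
      · subst huv
        have e3 : ∑ w ∈ S \ T, D.hard u w (φ u ^^ φ₁ w) ≤
            ∑ w ∈ S \ T, if w ∈ W then D.hardDeg u w else 0 := by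
          refine Finset.sum_le_sum fun w hw => ?_
          have h2 := Finset.single_le_sum (f := fun y => D.hard y w (φ y ^^ φ₁ w))
            (fun y _ => D.hard_nonneg y w _) huT
          rw [hhard w hw] at h2
          refine h2.trans ?_
          split_ifs
          · exact D.hard_le_hardDeg _ _ _
          · exact le_rfl
        rw [← Finset.sum_filter, Finset.filter_mem_eq_inter,
          Finset.inter_eq_right.2 hWT] at e3
        linarith
      · have e3 : ∑ w ∈ S \ T, D.hard u w (φ u ^^ φ₁ w) = 0 := by
          refine Finset.sum_eq_zero fun w hw => ?_
          have h2 := hhard w hw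
          rw [← Finset.add_sum_erase T _ hv, ] at h2
          have h3 := Finset.single_le_sum (f := fun y => D.hard y w (φ y ^^ φ₁ w))
            (fun y _ => D.hard_nonneg y w _) (Finset.mem_erase.2 ⟨huv, huT⟩)
          have h4 := D.hard_nonneg u w (φ u ^^ φ₁ w)
          have h5 := D.hard_nonneg v w (φ v ^^ φ₁ w)
          split_ifs at h2 <;> linarith
        rw [e3, zero_add]
        exact ho.load_le u huT
    · have hu' := Finset.mem_sdiff.2 ⟨hu, huT⟩
      have e1 : ∑ w ∈ T, (D.hard u w (Φ u ^^ Φ w) + O u w) =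
          ∑ y ∈ T, D.hard y u (φ y ^^ φ₁ u) + ∑ y ∈ T, D.flex y u (φ y ^^ φ₁ u) := by
        rw [← Finset.sum_add_distrib]
        refine Finset.sum_congr rfl fun w hw => ?_
        simp only [O, huT, hw, if_true, if_false, hΦR u hu', hΦT w hw]
        rw [D.hard_symm, D.flex_symm, Bool.xor_comm]
      have e2 : ∑ w ∈ S \ T, (D.hard u w (Φ u ^^ Φ w) + O u w) =
          ∑ w ∈ S \ T, (D'.hard u w (φ₁ u ^^ φ₁ w) + o₁ u w) := by
        refine Finset.sum_congr rfl fun w hw => ?_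
        simp only [O, huT, (Finset.mem_sdiff.1 hw).2, if_false, hΦR u hu', hΦR w hw, hD',
          contract, if_neg (hne u hu'), if_neg (hne w hw)]
      have h2 := h₁.load_le u (Finset.mem_insert_of_mem hu')
      have h2' : 0 ≤ D'.load (insert v (S \ T)) φ₁ o₁ u := load_nonneg h₁.nonneg u
      rw [load, Finset.sum_insert hvR] at h2
      have h3 := D'.hard_nonneg u v (φ₁ u ^^ φ₁ v)
      rw [e1, e2, hΦR u hu', hhard u hu']
      have h4 := hflex u hu'
      have h5 : D'.cap u (φ₁ u) = if u ∈ W then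
          max (-1) (D.cap u (φ₁ u) - D.hard v u (φ v ^^ φ₁ u)) else D.cap u (φ₁ u) := by
        simp [hD', contract, hne u hu']
      rw [load, Finset.sum_insert hvR] at h2'
      rw [h5] at h2
      split_ifs at h2 ⊢
      · rcases max_cases (-1) (D.cap u (φ₁ u) - D.hard v u (φ v ^^ φ₁ u)) with h | h <;>
          linarith
      · linarith

theorem contract_good {S : Finset V} (hi : 0 ≤ i) (hij : i ≤ j) (hS : D.Good S)
    (h1 : ∀ B ⊆ S \ T, ∑ u ∈ B, (if u ∈ W then D.hardDeg v u else 0) ≤ D.surplus B)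
    (h2 : ∀ B ⊆ S \ T, D.surplus T ≤
      D.surplus (T ∪ B) + i * ∑ u ∈ B, (if u ∈ W then D.hardDeg v u else 0))
    (h3 : ∀ u ∈ S \ T, ∑ y ∈ T, D.hardDeg y u - (if u ∈ W then D.hardDeg v u else 0) ≤ 1) :
    (D.contract T W v hv φ).Good (insert v (S \ T)) := by
  have hvR : v ∉ S \ T := fun h => (Finset.mem_sdiff.1 h).2 hv
  have hne : ∀ u ∈ S \ T, u ≠ v := fun u hu h => hvR (h ▸ hu)
  have hS' : ∀ u ∈ S \ T, u ∈ S := fun u hu => (Finset.mem_sdiff.1 hu).1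
  have hcap : ∀ u ∈ S \ T, ∀ b, (D.contract T W v hv φ).cap u b ≤ D.cap u b := by
    intro u hu b
    have := hS.neg_one_le u (hS' u hu) b
    have := D.hard_nonneg v u (φ v ^^ b)
    simp only [contract, if_neg (hne u hu)]
    split_ifs
    · exact max_le (by linarith) (by linarith)
    · exact le_rfl
  refine ⟨fun u hu b => ?_, fun u hu => ?_, fun u hu => ?_, fun u hu w hw => ?_,
    fun A hA => ?_⟩
  · simp only [contract]
    split_ifs with huv hb huW
    · norm_num
    · norm_num
    · exact le_max_left _ _
    · exact hS.neg_one_le u (hS' u ((Finset.mem_insert.1 hu).resolve_left huv)) b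
  · rcases Finset.mem_insert.1 hu with rfl | hu
    · simp only [contract, if_true]; simp; linarith
    · exact (hcap u hu _).trans (hS.poor_le u (hS' u hu))
  · rcases Finset.mem_insert.1 hu with rfl | hu
    · simp only [contract, if_true]; linarith
    · exact (hcap u hu _).trans (hS.rich_le u (hS' u hu))
  · rcases Finset.mem_insert.1 hu with hu | hu <;> rcases Finset.mem_insert.1 hw with hw | hw
    · rw [hu, hw, hardDeg_self]; norm_num
    · rw [hu, contract_hardDeg (hne w hw)]; exact h3 w hw
    · rw [hw, hardDeg_comm, contract_hardDeg (hne u hu)]; exact h3 u hu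
    · have := hS.hardDeg_le u (hS' u hu) w (hS' w hw)
      simpa only [hardDeg, contract, if_neg (hne u hu), if_neg (hne w hw)] using this
  · have hBR : A.erase v ⊆ S \ T := by
      intro u hu
      exact (Finset.mem_insert.1 (hA (Finset.mem_of_mem_erase hu))).resolve_left
        (Finset.ne_of_mem_erase hu)
    have h4 := contract_surplus (D := D) (W := W) (hv := hv) (φ := φ)
      (Finset.notMem_erase v A)
    by_cases hvA : v ∈ A
    · have h5 := (D.contract T W v hv φ).surplus_insert (Finset.notMem_erase v A)
      rw [Finset.insert_erase hvA, sum_wt,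
        Finset.sum_congr rfl fun u hu => contract_hardDeg (hne u (hBR hu)),
        Finset.sum_congr rfl fun u hu => contract_flexDeg (hne u (hBR hu)),
        Finset.sum_sub_distrib] at h5
      have h6 : (D.contract T W v hv φ).value v = i - j := by
        simp [value, contract]
      have h7 := D.surplus_union (A := T) (B := A.erase v)
        (Finset.disjoint_sdiff.mono_right hBR)
      rw [Finset.sum_comm, Finset.sum_congr rfl fun u _ => sum_wt_comm D T u,
        Finset.sum_add_distrib, ← Finset.mul_sum] at h7
      have h8 := h2 _ hBR
      linarith
    · rw [Finset.erase_eq_of_notMem hvA] at h4 hBR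
      have := h1 A hBR
      linarith

end contract

theorem colorable_of_slack {S T W : Finset V} {v : V} {φ : V → Bool} {o : V → V → ℤ} {k : ℤ}
    (hi : 0 ≤ i) (hij : i ≤ j) (hS : D.Good S) (hTS : T ⊆ S) (hT : 2 ≤ T.card) (hv : v ∈ T)
    (IH : ∀ S' : Finset V, S'.card < S.card → ∀ D' : FlexSystem V i j, D'.Good S' →
      D'.Colorable S')
    (hWT : W ⊆ S \ T)
    (ho : D.IsColoring T φ o) (hk : D.load T φ o v + k ≤ D.cap v (φ v))
    (hWk : ∑ w ∈ W, D.hardDeg v w ≤ k)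
    (h1 : ∀ B ⊆ S \ T, ∑ u ∈ B, (if u ∈ W then D.hardDeg v u else 0) ≤ D.surplus B)
    (h2 : ∀ B ⊆ S \ T, D.surplus T ≤
      D.surplus (T ∪ B) + i * ∑ u ∈ B, (if u ∈ W then D.hardDeg v u else 0))
    (h3 : ∀ u ∈ S \ T, ∑ y ∈ T, D.hardDeg y u - (if u ∈ W then D.hardDeg v u else 0) ≤ 1) :
    D.Colorable S := by
  refine colorable_of_contract (hv := hv) hTS hWT ho hk hWk
    (IH _ ?_ _ (contract_good hi hij hS h1 h2 h3))
  rw [Finset.card_insert_of_notMem fun h => (Finset.mem_sdiff.1 h).2 hv,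
    Finset.card_sdiff_of_subset hTS]
  have := Finset.card_le_card hTS
  omega

end FlexSystem

/-! ### Tight sets and full vertices of degree two -/

namespace FlexSystem

variable {V : Type*} [DecidableEq V] {i j : ℤ} {D : FlexSystem V i j} {S : Finset V}

theorem Good.surplus_insert_le (hS : D.Good S) {T : Finset V} {u : V} (hu : u ∈ S)
    (huT : u ∉ T) :
    D.surplus (insert u T) ≤
      D.surplus T + (2 * i + 1) - (i + 1) * ∑ y ∈ T, D.hardDeg y u := by
  rw [D.surplus_insert huT, sum_wt]
  have h1 := hS.value_le hu
  have h2 : 0 ≤ ∑ y ∈ T, D.flexDeg u y := Finset.sum_nonneg fun y _ => D.flexDeg_nonneg u y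
  rw [Finset.sum_congr rfl fun y _ => D.hardDeg_comm y u]
  linarith

/-- In a minimal counterexample a proper subset with at least two elements has positive surplus: a set
of surplus `0` sends at most one hard edge to each outer vertex, as two would cost more than the
value of that vertex, and so could be coloured and contracted. -/
theorem Good.one_le_surplus (hi : 0 ≤ i) (hij : i ≤ j) (hS : D.Good S)
    (IH : ∀ S' : Finset V, S'.card < S.card → ∀ D' : FlexSystem V i j, D'.Good S' →
      D'.Colorable S')
    (hne : ¬ D.Colorable S) {T : Finset V} (hTS : T ⊆ S) (hT : T ≠ S) (hT2 : 2 ≤ T.card) :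
    1 ≤ D.surplus T := by
  by_contra hlt
  have h0 : D.surplus T = 0 := by have := hS.surplus_nonneg T hTS; omega
  obtain ⟨φ, o, ho⟩ := IH T (Finset.card_lt_card (hTS.ssubset_of_ne hT)) D (hS.mono hTS)
  obtain ⟨v, hv⟩ : T.Nonempty := Finset.card_pos.1 (by omega)
  refine hne (colorable_of_slack (W := ∅) (k := 0) hi hij hS hTS hT2 hv IH (by simp) ho
    (by simpa using ho.load_le v hv) (by simp) (fun B hB => ?_) (fun B hB => ?_)
    (fun u hu => ?_))
  · simpa using hS.surplus_nonneg B (hB.trans Finset.sdiff_subset)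
  · simpa [h0] using hS.surplus_nonneg (T ∪ B)
      (Finset.union_subset hTS (hB.trans Finset.sdiff_subset))
  · obtain ⟨huS, huT⟩ := Finset.mem_sdiff.1 hu
    have h1 := hS.surplus_nonneg (insert u T) (Finset.insert_subset huS hTS)
    have h2 := hS.surplus_insert_le huS huT
    simp only [Finset.notMem_empty, if_false, sub_zero]
    by_contra h3
    nlinarith

/-- A colouring of `S.erase v` extends to `v` if `v` has no flexible edges and all loads stay within
the capacities. -/
theorem colorable_of_erase {v : V} (hv : v ∈ S)
    (hF : ∀ u ∈ S.erase v, D.flexDeg v u = 0) {φ : V → Bool} {o : V → V → ℤ}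
    (ho : ∀ u w, 0 ≤ o u w)
    (hflex : ∀ u ∈ S.erase v, ∀ w ∈ S.erase v, D.flex u w (φ u ^^ φ w) ≤ o u w + o w u) {a : Bool}
    (hload : ∀ u ∈ S.erase v,
      D.load (S.erase v) φ o u + D.hard v u (a ^^ φ u) ≤ D.cap u (φ u))
    (hloadv : ∑ u ∈ S.erase v, D.hard v u (a ^^ φ u) ≤ D.cap v a) : D.Colorable S := by
  have hne : ∀ u ∈ S.erase v, u ≠ v := fun u hu => Finset.ne_of_mem_erase hu
  have hF' : ∀ u ∈ S.erase v, ∀ b, D.flex v u b = 0 := by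
    intro u hu b
    have h1 := hF u hu
    have h2 := D.flex_nonneg v u false
    have h3 := D.flex_nonneg v u true
    simp only [flexDeg] at h1
    cases b <;> linarith
  let φ' : V → Bool := Function.update φ v a
  let o' : V → V → ℤ := fun u w => if u = v ∨ w = v then 0 else o u w
  have hφv : φ' v = a := by simp [φ']
  have hφ : ∀ u, u ≠ v → φ' u = φ u := fun u hu => by simp [φ', hu]
  refine ⟨φ', o', fun u w => ?_, fun u hu w hw => ?_, fun u hu => ?_⟩
  · simp only [o']
    split_ifs
    · exact le_rfl
    · exact ho u w
  · by_cases huv : u = v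
    · by_cases hwv : w = v
      · rw [huv, hwv, D.flex_self]; simp [o']
      · rw [huv, hF' w (Finset.mem_erase.2 ⟨hwv, hw⟩)]; simp [o']
    · by_cases hwv : w = v
      · rw [hwv, D.flex_symm, hF' u (Finset.mem_erase.2 ⟨huv, hu⟩)]; simp [o']
      · rw [hφ u huv, hφ w hwv]
        simpa [o', huv, hwv] using
          hflex u (Finset.mem_erase.2 ⟨huv, hu⟩) w (Finset.mem_erase.2 ⟨hwv, hw⟩)
  · by_cases huv : u = v
    · subst huv
      refine le_trans (le_of_eq ?_) (hloadv.trans_eq (by rw [hφv]))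
      rw [load, ← Finset.add_sum_erase S _ hv, D.hard_self]
      simp only [o', true_or, if_true, add_zero, zero_add]
      exact Finset.sum_congr rfl fun w hw => by rw [hφv, hφ w (hne w hw)]
    · refine le_trans (le_of_eq ?_)
        ((hload u (Finset.mem_erase.2 ⟨huv, hu⟩)).trans_eq (by rw [hφ u huv]))
      rw [load, ← Finset.add_sum_erase S _ hv, load, hφ u huv, hφv, D.hard_symm u v,
        Bool.xor_comm (φ u) a]
      simp only [o', or_true, if_true, add_zero]
      rw [add_comm]
      congr 1
      exact Finset.sum_congr rfl fun w hw => by simp [hφ w (hne w hw), huv, hne w hw]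

/-- The system with one more flexible edge, of sign `s`, between `y` and `z`. -/
def addFlex (D : FlexSystem V i j) (y z : V) (hyz : y ≠ z) (s : Bool) : FlexSystem V i j where
  cap := D.cap
  hard := D.hard
  flex u w b := D.flex u w b +
    ((if u = y ∧ w = z ∧ b = s then 1 else 0) + if u = z ∧ w = y ∧ b = s then 1 else 0)
  hard_nonneg := D.hard_nonneg
  flex_nonneg u w b := by
    have := D.flex_nonneg u w b
    split_ifs <;> linarith
  hard_symm := D.hard_symm
  flex_symm u w b := by
    rw [D.flex_symm, add_comm (ite (u = y ∧ w = z ∧ b = s) (1 : ℤ) 0)]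
    congr 2 <;> simp only [and_left_comm]
  hard_self := D.hard_self
  flex_self u b := by
    rw [D.flex_self, if_neg, if_neg]
    · rfl
    · rintro ⟨rfl, h, -⟩; exact hyz h.symm
    · rintro ⟨rfl, h, -⟩; exact hyz h

theorem addFlex_surplus (D : FlexSystem V i j) {y z : V} (hyz : y ≠ z) (s : Bool)
    (A : Finset V) :
    (D.addFlex y z hyz s).surplus A = D.surplus A - if y ∈ A ∧ z ∈ A then 1 else 0 := by
  have h1 := (D.addFlex y z hyz s).two_mul_surplus A
  have h2 := D.two_mul_surplus A
  have hw : ∀ u w, (D.addFlex y z hyz s).wt u w = D.wt u w +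
      ((if u = y then (if w = z then 1 else 0) else 0) +
        if u = z then (if w = y then 1 else 0) else 0) := by
    intro u w
    have e1 : (D.addFlex y z hyz s).hardDeg u w = D.hardDeg u w := rfl
    rw [wt, wt, e1, flexDeg, flexDeg]
    simp only [addFlex]
    cases s <;> simp only [ite_and] <;> simp <;> ring
  have e2 : ∀ u, (D.addFlex y z hyz s).value u = D.value u := fun u => rfl
  simp only [hw, e2, Finset.sum_add_distrib, Finset.sum_sub_distrib] at h1 h2
  have e3 : ∀ y z, ∑ u ∈ A, ∑ w ∈ A, (if u = y then (if w = z then (1 : ℤ) else 0) else 0) =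
      if y ∈ A ∧ z ∈ A then 1 else 0 := by
    intro y z
    rw [ite_and, Finset.sum_congr rfl fun u _ =>
      show ∑ w ∈ A, (if u = y then (if w = z then (1 : ℤ) else 0) else 0) =
        if u = y then (if z ∈ A then 1 else 0) else 0 by split_ifs <;> simp_all]
    simp
  rw [e3 y z, (e3 z y).trans (if_congr and_comm rfl rfl)] at h1
  linarith

/-- A full vertex whose only edges are two hard edges may be replaced by a flexible edge between its
neighbours. -/
theorem Good.colorable_of_degree_two (hi : 1 ≤ i) (hij : i ≤ j) (hS : D.Good S)
    (IH : ∀ S' : Finset V, S'.card < S.card → ∀ D' : FlexSystem V i j, D'.Good S' →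
      D'.Colorable S')
    {v : V} (hv : v ∈ S) (hval : 2 * i + 1 ≤ D.value v)
    (hH : ∑ u ∈ S.erase v, D.hardDeg v u = 2) (hF : ∑ u ∈ S.erase v, D.flexDeg v u = 0) :
    D.Colorable S := by
  set R := S.erase v with hR
  have hRS : ∀ u ∈ R, u ∈ S := fun u hu => Finset.mem_of_mem_erase hu
  have h01 : ∀ u ∈ R, D.hardDeg v u = if D.hardDeg v u = 1 then 1 else 0 := by
    intro u hu
    have h1 := D.hardDeg_nonneg v u
    have h2 := hS.hardDeg_le v hv u (hRS u hu)
    split_ifs with h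
    · exact h
    · omega
  obtain ⟨y, z, hyz, hfil⟩ : ∃ y z, y ≠ z ∧ R.filter (fun u => D.hardDeg v u = 1) = {y, z} := by
    rw [← Finset.card_eq_two]
    rw [Finset.sum_congr rfl h01, Finset.sum_boole] at hH
    exact_mod_cast hH
  have hmem : ∀ u, u ∈ R ∧ D.hardDeg v u = 1 ↔ u = y ∨ u = z := by
    intro u
    have := Finset.ext_iff.1 hfil u
    simpa using this
  obtain ⟨hyR, hy1⟩ := (hmem y).2 (Or.inl rfl)
  obtain ⟨hzR, hz1⟩ := (hmem z).2 (Or.inr rfl)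
  have hsign : ∀ u, D.hardDeg v u = 1 → ∃ s, ∀ b, D.hard v u b = if b = s then 1 else 0 := by
    intro u hu
    have h1 := D.hard_nonneg v u false
    have h2 := D.hard_nonneg v u true
    simp only [hardDeg] at hu
    rcases h1.eq_or_lt with h | h
    · exact ⟨true, by rintro (_ | _) <;> simp <;> linarith⟩
    · exact ⟨false, by rintro (_ | _) <;> simp <;> linarith⟩
  obtain ⟨sy, hsy⟩ := hsign y hy1
  obtain ⟨sz, hsz⟩ := hsign z hz1
  have hother : ∀ u ∈ R, u ≠ y → u ≠ z → ∀ b, D.hard v u b = 0 := by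
    intro u hu huy huz b
    have h1 : D.hardDeg v u = 0 := by
      rw [h01 u hu, if_neg]
      exact fun h => ((hmem u).1 ⟨hu, h⟩).elim huy huz
    exact le_antisymm (h1 ▸ D.hard_le_hardDeg v u b) (D.hard_nonneg v u b)
  have hF0 : ∀ u ∈ R, D.flexDeg v u = 0 :=
    (Finset.sum_eq_zero_iff_of_nonneg fun u _ => D.flexDeg_nonneg v u).1 hF
  -- the two colours of `v` fail to be free exactly if `y` and `z` conflict along the new edge
  obtain ⟨φ, o, ho⟩ := IH R (Finset.card_erase_lt_of_mem hv) (D.addFlex y z hyz (!(sy ^^ sz))) (by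
    refine ⟨fun u hu => hS.neg_one_le u (hRS u hu), fun u hu => hS.poor_le u (hRS u hu),
      fun u hu => hS.rich_le u (hRS u hu),
      fun u hu w hw => hS.hardDeg_le u (hRS u hu) w (hRS w hw), fun A hA => ?_⟩
    rw [addFlex_surplus]
    split_ifs with h
    · have hvA : v ∉ A := fun h => Finset.notMem_erase v S (hA h)
      have h1 := hS.surplus_nonneg (insert v A)
        (Finset.insert_subset hv (hA.trans (Finset.erase_subset _ _)))
      have h2 := hS.surplus_insert_le hv hvA
      have h3 : ∑ u ∈ ({y, z} : Finset V), D.hardDeg v u ≤ ∑ u ∈ A, D.hardDeg v u :=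
        Finset.sum_le_sum_of_subset_of_nonneg
          (by intro u hu; simp at hu; rcases hu with rfl | rfl; exacts [h.1, h.2])
          fun u _ _ => D.hardDeg_nonneg v u
      rw [Finset.sum_pair hyz, hy1, hz1] at h3
      rw [Finset.sum_congr rfl fun u _ => D.hardDeg_comm u v] at h2
      nlinarith
    · simpa using hS.surplus_nonneg A (hA.trans (Finset.erase_subset _ _)))
  have hflex : ∀ u ∈ R, ∀ w ∈ R, D.flex u w (φ u ^^ φ w) +
      ((if u = y ∧ w = z ∧ (φ u ^^ φ w) = !(sy ^^ sz) then 1 else 0) +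
        if u = z ∧ w = y ∧ (φ u ^^ φ w) = !(sy ^^ sz) then 1 else 0) ≤ o u w + o w u := ho.flex_le
  have hload : ∀ u ∈ R, D.load R φ o u ≤ D.cap u (φ u) := ho.load_le
  have hcap : ∀ a, 1 ≤ D.cap v a := by
    have h1 := hS.poor_le v hv
    have h2 := hS.rich_le v hv
    simp only [value] at hval
    rintro (_ | _) <;> linarith
  by_cases hc : (sy ^^ φ y) = (sz ^^ φ z)
  · -- one colour of `v` conflicts with neither neighbour
    have h0 : ∀ u ∈ R, D.hard v u ((!(sy ^^ φ y)) ^^ φ u) = 0 := by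
      intro u hu
      by_cases huy : u = y
      · subst huy; rw [hsy, if_neg]; cases sy <;> cases φ u <;> simp
      by_cases huz : u = z
      · subst huz; rw [hsz, if_neg]; rw [hc]; cases sz <;> cases φ u <;> simp
      exact hother u hu huy huz _
    refine colorable_of_erase hv hF0 ho.nonneg (fun u hu w hw => ?_) (φ := φ) (a := !(sy ^^ φ y))
      (fun u hu => ?_) ?_
    · have h1 := hflex u hu w hw
      split_ifs at h1 <;> linarith
    · rw [h0 u hu, add_zero]; exact hload u hu
    · rw [Finset.sum_congr rfl h0]
      simpa using zero_le_one.trans (hcap (!(sy ^^ φ y)))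
  · -- one of `y`, `z` carries the new edge, and `v` takes the colour conflicting with it
    have key : ∀ y' z' : V, ∀ sy' sz' : Bool, y' ≠ z' → y' ∈ R → z' ∈ R →
        (∀ b, D.hard v y' b = if b = sy' then 1 else 0) →
        (∀ b, D.hard v z' b = if b = sz' then 1 else 0) →
        (∀ u ∈ R, u ≠ y' → u ≠ z' → ∀ b, D.hard v u b = 0) →
        (sy' ^^ φ y') ≠ (sz' ^^ φ z') → 1 ≤ o y' z' →
        D.flex y' z' (φ y' ^^ φ z') + 1 ≤ o y' z' + o z' y' → D.Colorable S := by
      intro y z sy sz hyz hyR hzR hsy hsz hother hc hoyz hfl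
      have h0 : ∀ u ∈ R, D.hard v u ((sy ^^ φ y) ^^ φ u) = if u = y then 1 else 0 := by
        intro u hu
        by_cases huy : u = y
        · subst huy; rw [hsy, if_pos rfl, if_pos]; cases sy <;> cases φ u <;> simp
        rw [if_neg huy]
        by_cases huz : u = z
        · subst huz; rw [hsz, if_neg]; revert hc
          cases sz <;> cases φ u <;> cases sy <;> cases φ y <;> simp
        exact hother u hu huy huz _
      refine colorable_of_erase (φ := φ) (a := sy ^^ φ y)
        (o := fun u w => o u w - if u = y then (if w = z then 1 else 0) else 0) hv hF0
        (fun u w => ?_) (fun u hu w hw => ?_) (fun u hu => ?_) ?_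
      · have := ho.nonneg u w
        split_ifs with h1 h2
        · subst h1 h2; linarith
        · linarith
        · linarith
      · have h1 := hflex u hu w hw
        have h2 : D.flex u w (φ u ^^ φ w) ≤ o u w + o w u := by split_ifs at h1 <;> linarith
        by_cases huy : u = y
        · by_cases hwz : w = z
          · subst huy hwz; simp [hyz.symm]; linarith
          · simp [huy, hwz, hyz]; rw [← huy]; exact h2
        · by_cases hwy : w = y
          · by_cases huz : u = z
            · subst huz hwy
              rw [D.flex_symm, Bool.xor_comm]; simp [hyz.symm]; linarith
            · simp [huy, huz]; exact h2
          · simp [huy, hwy]; exact h2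
      · rw [h0 u hu]
        have h1 : D.load R φ (fun u w => o u w - if u = y then (if w = z then 1 else 0) else 0) u
            = D.load R φ o u - if u = y then 1 else 0 := by
          simp only [load, ← add_sub_assoc, Finset.sum_sub_distrib]
          by_cases huy : u = y
          · simp [huy, hzR]
          · simp [huy]
        rw [h1, sub_add_cancel]
        exact hload u hu
      · rw [Finset.sum_congr rfl h0, Finset.sum_ite_eq', if_pos hyR]
        exact hcap _
    have hb : (φ y ^^ φ z) = !(sy ^^ sz) := by
      revert hc
      cases sy <;> cases sz <;> cases φ y <;> cases φ z <;> simp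
    have h1 := hflex y hyR z hzR
    simp only [hb, hyz, and_true, if_true, if_false, false_and, add_zero] at h1
    rw [← hb] at h1
    by_cases h2 : 1 ≤ o y z
    · exact key y z sy sz hyz hyR hzR hsy hsz hother hc h2 h1
    · have h3 := D.flex_nonneg y z (φ y ^^ φ z)
      refine key z y sz sy hyz.symm hzR hyR hsz hsy (fun u hu h h' => hother u hu h' h)
        (Ne.symm hc) (by linarith) ?_
      rw [D.flex_symm, Bool.xor_comm]; linarith

end FlexSystem

/-! ### Vertices of small degree -/

namespace FlexSystem

variable {V : Type*} [DecidableEq V] {i j : ℤ} {D : FlexSystem V i j} {S : Finset V}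

/-- In a minimal counterexample the surplus of a set `A` pays for one unit of capacity per hard edge
between `v` and `A`, if edges to tight vertices are not counted. With one edge the reason is that
`A` is not tight, with three or more that the value of `v` is less than their cost; with two, the
exception is the vertex treated in `Good.colorable_of_degree_two`. -/
theorem Good.sum_le_surplus (hi : 1 ≤ i) (hij : i ≤ j) (hS : D.Good S)
    (IH : ∀ S' : Finset V, S'.card < S.card → ∀ D' : FlexSystem V i j, D'.Good S' →
      D'.Colorable S')
    (hne : ¬ D.Colorable S) {v : V} (hv : v ∈ S) (e : V → ℤ)
    (he : ∀ u, e u ≤ D.hardDeg v u) (het : ∀ u ∈ S, D.value u = i - j → e u = 0)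
    {A : Finset V} (hA : A ⊆ S.erase v) : ∑ u ∈ A, e u ≤ D.surplus A := by
  have hAS : A ⊆ S := hA.trans (Finset.erase_subset _ _)
  have hvA : v ∉ A := fun h => Finset.notMem_erase v S (hA h)
  have hA' : A ≠ S := fun h => hvA (h ▸ hv)
  have h0 := hS.surplus_nonneg A hAS
  have hins := hS.surplus_nonneg (insert v A) (Finset.insert_subset hv hAS)
  have hins' := D.surplus_insert hvA
  rw [sum_wt] at hins'
  have hval := hS.value_le hv
  have hn : ∑ u ∈ A, e u ≤ ∑ u ∈ A, D.hardDeg v u := Finset.sum_le_sum fun u _ => he u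
  have hF : 0 ≤ ∑ u ∈ A, D.flexDeg v u := Finset.sum_nonneg fun u _ => D.flexDeg_nonneg v u
  set n := ∑ u ∈ A, e u with hn'
  set H := ∑ u ∈ A, D.hardDeg v u with hH
  by_contra hlt
  push Not at hlt
  have hAne : A.Nonempty := by
    by_contra h
    rw [Finset.not_nonempty_iff_eq_empty.1 h, Finset.sum_empty] at hn'
    omega
  have hcard := Finset.card_pos.2 hAne
  by_cases h3 : 3 ≤ n
  · nlinarith
  by_cases h2 : n = 2
  · have hins2 : D.surplus (insert v A) < 1 := by nlinarith
    have hall : insert v A = S := by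
      by_contra h
      have := hS.one_le_surplus (by linarith) hij IH hne (Finset.insert_subset hv hAS) h
        (by rw [Finset.card_insert_of_notMem hvA]; omega)
      omega
    have hAR : A = S.erase v := by rw [← hall, Finset.erase_insert hvA]
    have hH2 : H = 2 := by nlinarith
    refine hne (hS.colorable_of_degree_two hi hij IH hv ?_ ?_ ?_)
    · rw [hH2] at hins'; linarith
    · rw [← hAR]; exact hH2
    · rw [← hAR]; rw [hH2] at hins'; linarith
  · have hn1 : n = 1 := by omega
    have hA1 : A.card < 2 := by
      by_contra h
      have := hS.one_le_surplus (by linarith) hij IH hne hAS hA' (by omega)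
      omega
    obtain ⟨x, rfl⟩ := Finset.card_eq_one.1 (by omega : A.card = 1)
    rw [surplus_singleton] at h0 hlt
    have := het x (hAS (Finset.mem_singleton_self x)) (by omega)
    rw [Finset.sum_singleton] at hn'
    omega

/-- In a minimal counterexample the deletion of `v` with colour `a` fails, and a set whose surplus is
too small for the flexible edges at `v` is the obstruction. -/
theorem Good.exists_failing_set (hi : 1 ≤ i) (hij : i ≤ j) (hS : D.Good S)
    (IH : ∀ S' : Finset V, S'.card < S.card → ∀ D' : FlexSystem V i j, D'.Good S' →
      D'.Colorable S')
    (hne : ¬ D.Colorable S) {v : V} (hv : v ∈ S) (a : Bool) (e : V → ℤ) (he0 : ∀ u, 0 ≤ e u)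
    (he : ∀ u, e u ≤ D.hardDeg v u) (het : ∀ u ∈ S, D.value u = i - j → e u = 0)
    (hea : ∀ u ∈ S.erase v,
      D.hardDeg v u ≤ e u ∨ ∀ b, 0 ≤ D.cap u b → D.hard v u (a ^^ b) = 0)
    (hd : ∑ u ∈ S.erase v, e u ≤ D.cap v a) :
    ∃ A ⊆ S.erase v, D.surplus A + D.cap v a <
      ∑ u ∈ A, D.flexDeg v u + ∑ u ∈ A, e u + ∑ u ∈ S.erase v, e u := by
  by_contra hA
  push Not at hA
  obtain ⟨φ, o, ho, -⟩ := exists_isColoring_of_erase (slack := 0) (by linarith) hS hv a e le_rfl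
    (IH _ (Finset.card_erase_lt_of_mem hv)) he0 hea (by simpa using hd)
    (fun A hA => hS.sum_le_surplus hi hij IH hne hv e he het hA)
    (fun A hA' => by simpa using hA A hA')
  exact hne ⟨φ, o, ho⟩

/-- In a minimal counterexample a neighbour `v` of a tight vertex `x` contributes negatively to the
doubled surplus, where both halves of the edge from `v` to `x` are charged to `v`. The colour of
`v` is the one that does not conflict with the forced colour of `x`. -/
theorem Good.degree_of_adj_tight (hi : 2 ≤ i) (hij : 2 * i + 1 ≤ j) (hS : D.Good S)
    (IH : ∀ S' : Finset V, S'.card < S.card → ∀ D' : FlexSystem V i j, D'.Good S' →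
      D'.Colorable S')
    (hne : ¬ D.Colorable S) {x : V} (hx : x ∈ S) (hxv : D.value x = i - j)
    (huniq : ∀ u ∈ S, D.value u = i - j → u = x) {v : V} (hv : v ∈ S)
    (hvx : D.hardDeg v x = 1) :
    2 * D.value v < (i + 1) * (D.hardDeg v x + ∑ u ∈ S, D.hardDeg v u) := by
  have hvx' : v ≠ x := by rintro rfl; rw [hardDeg_self] at hvx; omega
  have hxR : x ∈ S.erase v := Finset.mem_erase.2 ⟨hvx'.symm, hx⟩
  obtain ⟨a, ha⟩ : ∃ a, ∀ b, 0 ≤ D.cap x b → D.hard v x (a ^^ b) = 0 := by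
    have h1 := hS.neg_one_le x hx
    have h2 := h1 false
    have h3 := h1 true
    obtain ⟨bx, hbx⟩ : ∃ bx, ∀ b, 0 ≤ D.cap x b → b = bx := by
      simp only [value] at hxv
      by_cases h : D.cap x true = 0
      · exact ⟨true, by rintro (_ | _) <;> simp; omega⟩
      · exact ⟨false, by rintro (_ | _) <;> simp; omega⟩
    have h4 := D.hard_nonneg v x false
    have h5 := D.hard_nonneg v x true
    simp only [hardDeg] at hvx
    obtain ⟨s, hs⟩ : ∃ s, D.hard v x s = 0 := by
      by_cases h : D.hard v x true = 0
      · exact ⟨true, h⟩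
      · exact ⟨false, by omega⟩
    exact ⟨s ^^ bx, fun b hb => by rw [hbx b hb]; simpa using hs⟩
  let e : V → ℤ := fun u => if u = x then 0 else D.hardDeg v u
  have he0 : ∀ u, 0 ≤ e u := fun u => by
    simp only [e]; split_ifs; exacts [le_rfl, D.hardDeg_nonneg v u]
  have he : ∀ u, e u ≤ D.hardDeg v u := fun u => by
    simp only [e]; split_ifs; exacts [D.hardDeg_nonneg v u, le_rfl]
  have hsum : ∀ A : Finset V, x ∈ A → ∑ u ∈ A, D.hardDeg v u = ∑ u ∈ A, e u + 1 := by
    intro A hxA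
    rw [← Finset.add_sum_erase A _ hxA, ← Finset.add_sum_erase A e hxA, hvx]
    rw [Finset.sum_congr rfl fun u hu =>
      show e u = D.hardDeg v u from if_neg (Finset.ne_of_mem_erase hu)]
    simp only [e, if_true]; ring
  have htot : ∑ u ∈ S, D.hardDeg v u = ∑ u ∈ S.erase v, e u + 1 := by
    rw [← hsum _ hxR, ← Finset.add_sum_erase S _ hv, hardDeg_self, zero_add]
  rw [htot, hvx]
  set d := ∑ u ∈ S.erase v, e u with hd
  have hd0 : 0 ≤ d := Finset.sum_nonneg fun u _ => he0 u
  have hvalc : D.value v - (i + 1) ≤ D.cap v a := by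
    have h1 := hS.poor_le v hv
    have h2 := hS.rich_le v hv
    simp only [value]
    cases a <;> linarith
  have hca := hS.neg_one_le v hv a
  have hval := hS.value_le hv
  by_contra hlt
  push Not at hlt
  have hd1 : d ≤ 1 := by
    by_contra h
    have : 2 ≤ d := by omega
    nlinarith
  have hdc : d ≤ D.cap v a := by
    by_contra h
    have : D.cap v a + 1 ≤ d := by omega
    nlinarith
  obtain ⟨A, hA, hAf⟩ := hS.exists_failing_set (by linarith) (by linarith) IH hne hv a e he0 he
    (fun u hu h => if_pos (huniq u hu h))
    (fun u hu => by
      by_cases hux : u = x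
      · subst hux; exact Or.inr ha
      · exact Or.inl (if_neg hux).ge) hdc
  -- adding the tight vertex to the failing set keeps it failing
  obtain ⟨A, hA, hxA, hAf⟩ : ∃ A ⊆ S.erase v, x ∈ A ∧ D.surplus A + D.cap v a <
      ∑ u ∈ A, D.flexDeg v u + ∑ u ∈ A, e u + d := by
    by_cases hxA : x ∈ A
    · exact ⟨A, hA, hxA, hAf⟩
    · refine ⟨insert x A, Finset.insert_subset hxR hA, Finset.mem_insert_self x A, ?_⟩
      rw [Finset.sum_insert hxA, Finset.sum_insert hxA, D.surplus_insert hxA, hxv]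
      have h1 := D.flexDeg_nonneg v x
      have h2 := he0 x
      have h3 : 0 ≤ ∑ u ∈ A, D.wt x u :=
        Finset.sum_nonneg fun u _ => D.wt_nonneg (by linarith) x u
      linarith
  have hAS : A ⊆ S := hA.trans (Finset.erase_subset _ _)
  have hvA : v ∉ A := fun h => Finset.notMem_erase v S (hA h)
  have hins := D.surplus_insert hvA
  rw [sum_wt, hsum A hxA] at hins
  have hins0 := hS.surplus_nonneg _ (Finset.insert_subset hv hAS)
  have hAe : 0 ≤ ∑ u ∈ A, e u := Finset.sum_nonneg fun u _ => he0 u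
  have hlt1 : D.surplus (insert v A) < d - i * ∑ u ∈ A, e u := by linarith
  have hall : insert v A = S := by
    by_contra h
    have := hS.one_le_surplus (by linarith) (by linarith) IH hne
      (Finset.insert_subset hv hAS) h
      (by rw [Finset.card_insert_of_notMem hvA]; have := Finset.card_pos.2 ⟨x, hxA⟩; omega)
    nlinarith
  have hAR : A = S.erase v := by rw [← hall, Finset.erase_insert hvA]
  rw [hAR, ← hd] at hlt1
  rw [hAR] at hins0
  nlinarith

/-- In a minimal counterexample a vertex `v` that is not adjacent to a tight vertex and has at most
three hard edges has more hard edges than capacity in any colour `a` worth its value. Otherwise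
`v` cannot be deleted because of some set `T` around it with very small surplus; for a minimal such
`T`, the set can be coloured so that `v` has `surplus T` units to spare, and then contracted after
deleting that many of the hard edges leaving `T` at `v`, which makes up for the surplus of `T`. -/
theorem Good.degree_of_not_adj_tight (hi : 2 ≤ i) (hij : 2 * i + 1 ≤ j) (hS : D.Good S)
    (IH : ∀ S' : Finset V, S'.card < S.card → ∀ D' : FlexSystem V i j, D'.Good S' →
      D'.Colorable S')
    (hne : ¬ D.Colorable S) {v : V} (hv : v ∈ S)
    (hvt : ∀ u ∈ S, D.value u = i - j → D.hardDeg v u = 0) (a : Bool)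
    (hvalc : D.value v ≤ D.cap v a) (hd3 : ∑ u ∈ S, D.hardDeg v u ≤ 3) :
    D.cap v a < ∑ u ∈ S, D.hardDeg v u := by
  have hij' : i ≤ j := by linarith
  have hi1 : 1 ≤ i := by linarith
  have herase : ∀ T : Finset V, v ∈ T → ∑ u ∈ T.erase v, D.hardDeg v u =
      ∑ u ∈ T, D.hardDeg v u := by
    intro T hvT
    rw [← Finset.add_sum_erase T _ hvT, hardDeg_self, zero_add]
  have hH0 : ∀ T : Finset V, 0 ≤ ∑ u ∈ T, D.hardDeg v u := fun T =>
    Finset.sum_nonneg fun u _ => D.hardDeg_nonneg v u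
  set d := ∑ u ∈ S, D.hardDeg v u with hd
  by_contra hdc
  push Not at hdc
  have hval := hS.value_le hv
  obtain ⟨A, hA, hAf⟩ := hS.exists_failing_set hi1 hij' IH hne hv a (D.hardDeg v)
    (D.hardDeg_nonneg v) (fun u => le_rfl) hvt (fun u _ => Or.inl le_rfl)
    (by rw [herase S hv]; exact hdc)
  rw [herase S hv, ← hd] at hAf
  -- the sets whose surplus is less than the number of hard edges that leave them at `v`; the weight
  -- minimized below prefers a small surplus, then few hard edges inside
  set C := S.powerset.filter fun T => v ∈ T ∧ T ≠ {v} ∧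
    D.surplus T + ∑ u ∈ T, D.hardDeg v u ≤ d - 1 with hC
  have hCmem : ∀ T, T ∈ C ↔ T ⊆ S ∧ v ∈ T ∧ T ≠ {v} ∧
      D.surplus T + ∑ u ∈ T, D.hardDeg v u ≤ d - 1 := by
    intro T; rw [hC, Finset.mem_filter, Finset.mem_powerset]
  have hinsC : ∀ A : Finset V, v ∉ A → A.Nonempty → insert v A ≠ {v} := by
    intro A hvA ⟨y, hy⟩ h
    have : y ∈ ({v} : Finset V) := h ▸ Finset.mem_insert_of_mem hy
    exact hvA (Finset.mem_singleton.1 this ▸ hy)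
  have hins : ∀ A : Finset V, v ∉ A → D.surplus (insert v A) ≤ D.surplus A + D.cap v a -
      ((i + 1) * ∑ u ∈ A, D.hardDeg v u + ∑ u ∈ A, D.flexDeg v u) := by
    intro A hvA
    rw [D.surplus_insert hvA, sum_wt]
    linarith
  have hCne : C.Nonempty := by
    have hvA : v ∉ A := fun h => Finset.notMem_erase v S (hA h)
    refine ⟨insert v A, (hCmem _).2 ⟨Finset.insert_subset hv (hA.trans (Finset.erase_subset _ _)),
      Finset.mem_insert_self _ _, hinsC A hvA ?_, ?_⟩⟩
    · by_contra h
      rw [Finset.not_nonempty_iff_eq_empty.1 h] at hAf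
      simp only [Finset.sum_empty, surplus_empty] at hAf
      linarith
    · have h1 := hins A hvA
      rw [Finset.sum_insert hvA, hardDeg_self]
      nlinarith [hH0 A]
  obtain ⟨T, hTC, hTmin⟩ := Finset.exists_min_image C
    (fun T => 2 * D.surplus T + ∑ u ∈ T, D.hardDeg v u) hCne
  have hCsurp : ∀ T ∈ C, 1 ≤ D.surplus T ∧ 2 ≤ T.card ∧ T ≠ S := by
    intro T hT
    obtain ⟨hTS, hvT, hTv, hTd⟩ := (hCmem T).1 hT
    have hne' : T ≠ S := by
      rintro rfl
      have := hS.surplus_nonneg T hTS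
      linarith
    have hcard : 2 ≤ T.card := by
      by_contra h
      have := Finset.card_pos.2 ⟨v, hvT⟩
      obtain ⟨y, rfl⟩ := Finset.card_eq_one.1 (by omega : T.card = 1)
      exact hTv (by rw [Finset.mem_singleton.1 hvT])
    exact ⟨hS.one_le_surplus (by linarith) hij' IH hne hTS hne' hcard, hcard, hne'⟩
  obtain ⟨hTS, hvT, hTv, hTd⟩ := (hCmem T).1 hTC
  obtain ⟨hT1, hTcard, hTne⟩ := hCsurp T hTC
  have hTH0 := hH0 T
  -- enough hard edges leave `T` at `v`
  have h01 : ∀ u ∈ S, D.hardDeg v u = if D.hardDeg v u = 1 then 1 else 0 := by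
    intro u hu
    have h1 := D.hardDeg_nonneg v u
    have h2 := hS.hardDeg_le v hv u hu
    split_ifs with h
    · exact h
    · omega
  obtain ⟨W, hW, hWk⟩ : ∃ W ⊆ (S \ T).filter (fun u => D.hardDeg v u = 1),
      W.card = (D.surplus T).toNat := by
    apply Finset.exists_subset_card_eq
    have h1 : ∑ u ∈ S \ T, D.hardDeg v u + ∑ u ∈ T, D.hardDeg v u = d :=
      Finset.sum_sdiff hTS
    rw [Finset.sum_congr rfl fun u hu => h01 u (Finset.sdiff_subset hu),
      Finset.sum_boole] at h1
    omega
  have hWT : W ⊆ S \ T := hW.trans (Finset.filter_subset _ _)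
  have hW1 : ∀ w ∈ W, D.hardDeg v w = 1 := fun w hw => (Finset.mem_filter.1 (hW hw)).2
  have hWsum : ∑ w ∈ W, D.hardDeg v w = D.surplus T := by
    rw [Finset.sum_congr rfl hW1]
    simp only [Finset.sum_const, nsmul_eq_mul, mul_one, hWk]
    omega
  -- colour `T` so that `v` can still bear `surplus T` further hard edges
  obtain ⟨φ, o, ho, hφ, hload⟩ := exists_isColoring_of_erase (slack := D.surplus T)
    (by linarith) (hS.mono hTS) hvT a (D.hardDeg v) (by linarith)
    (IH _ (lt_of_lt_of_le (Finset.card_erase_lt_of_mem hvT) (Finset.card_le_card hTS)))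
    (D.hardDeg_nonneg v) (fun u _ => Or.inl le_rfl)
    (by rw [herase T hvT]; linarith)
    (fun A hA => hS.sum_le_surplus hi1 hij' IH hne hv _
      (fun u => le_rfl) hvt (hA.trans (Finset.erase_subset_erase v hTS)))
    (fun A hA => by
      rw [herase T hvT]
      by_contra hlt
      push Not at hlt
      have hvA : v ∉ A := fun h => Finset.notMem_erase v T (hA h)
      have h1 := hins A hvA
      have hAH := hH0 A
      have hmem : insert v A ∈ C := by
        refine (hCmem _).2 ⟨Finset.insert_subset hv ((hA.trans (Finset.erase_subset _ _)).trans
          hTS), Finset.mem_insert_self _ _, hinsC A hvA ?_, ?_⟩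
        · by_contra h
          rw [Finset.not_nonempty_iff_eq_empty.1 h] at hlt
          simp only [Finset.sum_empty, surplus_empty] at hlt
          linarith
        · rw [Finset.sum_insert hvA, hardDeg_self]
          nlinarith
      have h2 := hTmin _ hmem
      have h3 := (hCsurp _ hmem).1
      simp only [Finset.sum_insert hvA, hardDeg_self] at h2
      nlinarith)
  have hδ0 : ∀ u, 0 ≤ if u ∈ W then D.hardDeg v u else 0 := fun u => by
    split_ifs; exacts [D.hardDeg_nonneg v u, le_rfl]
  have h2 : ∀ B ⊆ S \ T, D.surplus T ≤
      D.surplus (T ∪ B) + i * ∑ u ∈ B, (if u ∈ W then D.hardDeg v u else 0) := by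
    intro B hB
    have hTB : T ∪ B ⊆ S := Finset.union_subset hTS (hB.trans Finset.sdiff_subset)
    have hs0 := hS.surplus_nonneg _ hTB
    have hδ : 0 ≤ ∑ u ∈ B, (if u ∈ W then D.hardDeg v u else 0) :=
      Finset.sum_nonneg fun u _ => hδ0 u
    rcases hδ.eq_or_lt with hz | hpos
    · rw [← hz, mul_zero, add_zero]
      by_contra hlt
      push Not at hlt
      have hWB : W ⊆ S \ (T ∪ B) := by
        intro w hw
        have hw' := Finset.mem_sdiff.1 (hWT hw)
        refine Finset.mem_sdiff.2 ⟨hw'.1, fun h => ?_⟩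
        have hwB := (Finset.mem_union.1 h).resolve_left hw'.2
        have := (Finset.sum_eq_zero_iff_of_nonneg fun u _ => hδ0 u).1 hz.symm w hwB
        rw [if_pos hw, hW1 w hw] at this
        omega
      have h4 : ∑ u ∈ S \ (T ∪ B), D.hardDeg v u + ∑ u ∈ T ∪ B, D.hardDeg v u = d :=
        Finset.sum_sdiff hTB
      have h5 : ∑ u ∈ W, D.hardDeg v u ≤ ∑ u ∈ S \ (T ∪ B), D.hardDeg v u :=
        Finset.sum_le_sum_of_subset_of_nonneg hWB fun u _ _ => D.hardDeg_nonneg v u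
      have hmem : T ∪ B ∈ C := by
        refine (hCmem _).2 ⟨hTB, Finset.mem_union_left _ hvT, fun h => ?_, by linarith⟩
        have := Finset.card_le_card (Finset.subset_union_left (s₁ := T) (s₂ := B))
        rw [h, Finset.card_singleton] at this
        omega
      have h6 := hTmin _ hmem
      have h7 := (hCsurp _ hmem).1
      have h8 := ((hCmem _).1 hmem).2.2.2
      linarith
    · nlinarith
  refine hne (colorable_of_slack (by linarith) hij' hS hTS hTcard hvT IH hWT ho
    (by rw [hφ]; exact hload) hWsum.le
    (fun B hB => hS.sum_le_surplus hi1 hij' IH hne hv _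
      (fun u => by split_ifs; exacts [le_rfl, D.hardDeg_nonneg v u])
      (fun u hu h => by rw [hvt u hu h, ite_self])
      (fun u hu => Finset.mem_erase.2 ⟨fun h => (Finset.mem_sdiff.1 (hB hu)).2 (h ▸ hvT),
        (Finset.mem_sdiff.1 (hB hu)).1⟩)) h2 (fun u hu => ?_))
  obtain ⟨huS, huT⟩ := Finset.mem_sdiff.1 hu
  have h3 := hS.surplus_insert_le huS huT
  have h4 := h2 {u} (by simpa using ⟨huS, huT⟩)
  have h5 := hS.surplus_nonneg _ (Finset.insert_subset huS hTS)
  rw [Finset.sum_singleton, Finset.union_comm, Finset.singleton_union] at h4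
  by_contra hlt
  push Not at hlt
  split_ifs at h4 hlt with huW
  · rw [hW1 u huW] at h4 hlt
    nlinarith
  · nlinarith

end FlexSystem

/-! ### Counting -/

namespace FlexSystem

variable {V : Type*} [DecidableEq V] {i j : ℤ} {D : FlexSystem V i j} {S : Finset V}

theorem Good.degree_bounds (hi : 2 ≤ i) (hij : 2 * i + 1 ≤ j) (hS : D.Good S)
    (IH : ∀ S' : Finset V, S'.card < S.card → ∀ D' : FlexSystem V i j, D'.Good S' →
      D'.Colorable S')
    (hne : ¬ D.Colorable S) {v : V} (hv : v ∈ S)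
    (hvt : ∀ u ∈ S, D.value u = i - j → D.hardDeg v u = 0) :
    2 * D.value v + 2 ≤ (i + 1) * ∑ u ∈ S, D.hardDeg v u ∧
      2 * D.cap v false < (i + 1) * ∑ u ∈ S, D.hardDeg v u := by
  have h1 := hS.poor_le v hv
  have h2 := hS.rich_le v hv
  have h3 := hS.neg_one_le v hv
  have hval := hS.value_le hv
  obtain ⟨a, ha0, ha⟩ : ∃ a, D.cap v false ≤ D.cap v a ∧ D.value v ≤ D.cap v a := by
    simp only [value]
    by_cases h : D.cap v false ≤ D.cap v true
    · exact ⟨true, h, by linarith⟩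
    · exact ⟨false, le_rfl, by linarith⟩
  have hdeg := hS.degree_of_not_adj_tight hi hij IH hne hv hvt a ha
  set d := ∑ u ∈ S, D.hardDeg v u
  have h4 := h3 a
  have h5 := h3 false
  by_cases hd : d ≤ 3
  · have h6 : D.cap v a + 1 ≤ d := hdeg hd
    constructor <;> nlinarith
  · have h6 : 4 ≤ d := by omega
    constructor <;> nlinarith

/-- With a tight vertex, summing the contributions of the other vertices gives a negative surplus. -/
theorem Good.colorable_of_tight (hi : 2 ≤ i) (hij : 2 * i + 1 ≤ j) (hS : D.Good S)
    (IH : ∀ S' : Finset V, S'.card < S.card → ∀ D' : FlexSystem V i j, D'.Good S' →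
      D'.Colorable S')
    {x : V} (hx : x ∈ S) (hxv : D.value x = i - j) : D.Colorable S := by
  by_contra hne
  have huniq : ∀ u ∈ S, D.value u = i - j → u = x := by
    intro u hu huv
    by_contra hux
    have h1 := hS.surplus_nonneg {u, x} (Finset.insert_subset hu (by simpa using hx))
    rw [D.surplus_insert (by simpa using hux), surplus_singleton, Finset.sum_singleton] at h1
    have := D.wt_nonneg (by linarith) u x
    linarith
  have hterm : ∀ v ∈ S.erase x, 2 * D.value v - ∑ u ∈ S, D.wt v u - D.wt x v < 0 := by
    intro v hv
    obtain ⟨hvx, hvS⟩ := Finset.mem_erase.1 hv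
    have h1 : 2 * D.value v < (i + 1) * (D.hardDeg v x + ∑ u ∈ S, D.hardDeg v u) := by
      have h2 := D.hardDeg_nonneg v x
      have h3 := hS.hardDeg_le v hvS x hx
      by_cases hadj : D.hardDeg v x = 1
      · exact hS.degree_of_adj_tight hi hij IH hne hx hxv huniq hvS hadj
      · have h0 : D.hardDeg v x = 0 := by omega
        have := (hS.degree_bounds hi hij IH hne hvS
          (fun u hu huv => by rw [huniq u hu huv]; exact h0)).1
        rw [h0]; linarith
    rw [sum_wt]
    have h2 : 0 ≤ ∑ u ∈ S, D.flexDeg v u := Finset.sum_nonneg fun u _ => D.flexDeg_nonneg v u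
    have h3 := D.flexDeg_nonneg x v
    rw [wt, D.hardDeg_comm x v]
    nlinarith
  have hsum : 2 * D.surplus S =
      ∑ v ∈ S.erase x, (2 * D.value v - ∑ u ∈ S, D.wt v u - D.wt x v) := by
    have h1 : ∑ v ∈ S.erase x, D.wt x v = ∑ v ∈ S, D.wt x v := by
      rw [← Finset.add_sum_erase S _ hx, wt_self, zero_add]
    rw [two_mul_surplus, ← Finset.add_sum_erase S _ hx, hxv, Finset.sum_sub_distrib _ (D.wt x),
      h1]
    ring
  have hnn := hS.surplus_nonneg S subset_rfl
  rcases (S.erase x).eq_empty_or_nonempty with hem | hnem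
  · -- a single vertex takes the colour of its nonnegative capacity
    have hSx : S = {x} := by rw [← Finset.insert_erase hx, hem]; rfl
    have h1 := hS.neg_one_le x hx
    have h2 := h1 false
    have h3 := h1 true
    obtain ⟨b, hb⟩ : ∃ b, 0 ≤ D.cap x b := by
      simp only [value] at hxv
      by_cases h : 0 ≤ D.cap x true
      · exact ⟨true, h⟩
      · exact ⟨false, by omega⟩
    refine hne ⟨fun _ => b, fun _ _ => 0, ⟨fun _ _ => le_rfl, ?_, ?_⟩⟩ <;>
      simp [hSx, load, D.flex_self, D.hard_self, hb]
  · have := Finset.sum_lt_sum_of_nonempty hnem hterm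
    rw [← hsum, Finset.sum_const_zero] at this
    linarith

/-- Without tight vertices, either all vertices can be made rich, or some vertex `v` has so many edges
that the contributions of `v` and its neighbours make the surplus negative. -/
theorem Good.colorable_of_forall_not_tight (hi : 2 ≤ i) (hij : 2 * i + 1 ≤ j) (hS : D.Good S)
    (IH : ∀ S' : Finset V, S'.card < S.card → ∀ D' : FlexSystem V i j, D'.Good S' →
      D'.Colorable S')
    (hnt : ∀ u ∈ S, D.value u ≠ i - j) : D.Colorable S := by
  by_contra hne
  have hdeg := fun {v} (hv : v ∈ S) => hS.degree_bounds hi hij IH hne hv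
    fun u hu huv => (hnt u hu huv).elim
  -- making every vertex rich, and letting both ends carry each flexible edge, fails at some `v`
  obtain ⟨v, hv, hvc⟩ : ∃ v ∈ S,
      D.cap v true < ∑ u ∈ S, D.hardDeg v u + ∑ u ∈ S, D.flexDeg v u := by
    by_contra hall
    push Not at hall
    refine hne ⟨fun _ => true, D.flexDeg, ⟨D.flexDeg_nonneg, fun u _ w _ => ?_,
      fun u hu => le_trans ?_ (hall u hu)⟩⟩
    · have h1 := D.flexDeg_nonneg w u
      have h2 := D.flex_nonneg u w true
      simp only [flexDeg, Bool.xor_self] at h1 ⊢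
      linarith
    · rw [load, Finset.sum_add_distrib]
      gcongr with w _
      exact D.hard_le_hardDeg _ _ _
  have hnn := D.two_mul_surplus S
  rw [← Finset.add_sum_erase S _ hv] at hnn
  have hle : ∑ u ∈ S.erase v, (2 * D.value u - ∑ w ∈ S, D.wt u w) ≤
      ∑ u ∈ S.erase v, (-2 * D.hardDeg v u - D.flexDeg v u) := by
    refine Finset.sum_le_sum fun u hu => ?_
    have huS := Finset.mem_of_mem_erase hu
    have h1 := (hdeg huS).1
    have h2 := hS.hardDeg_le v hv u huS
    have h3 := Finset.single_le_sum (f := D.flexDeg u) (fun w _ => D.flexDeg_nonneg u w) hv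
    rw [D.flexDeg_comm u v] at h3
    rw [sum_wt]
    linarith
  have e1 : ∑ u ∈ S.erase v, D.hardDeg v u = ∑ u ∈ S, D.hardDeg v u := by
    rw [← Finset.add_sum_erase S _ hv, hardDeg_self, zero_add]
  have e2 : ∑ u ∈ S.erase v, D.flexDeg v u = ∑ u ∈ S, D.flexDeg v u := by
    rw [← Finset.add_sum_erase S _ hv, flexDeg_self, zero_add]
  rw [Finset.sum_sub_distrib (fun u => -2 * D.hardDeg v u), ← Finset.mul_sum, e1, e2] at hle
  have h0 := hS.surplus_nonneg S subset_rfl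
  have h1 := (hdeg hv).2
  rw [sum_wt, value] at hnn
  linarith

/-- A system in which no set of vertices has negative surplus is colourable. -/
theorem Good.colorable (hi : 2 ≤ i) (hij : 2 * i + 1 ≤ j) (hS : D.Good S) : D.Colorable S := by
  induction hn : S.card using Nat.strong_induction_on generalizing S D with
  | _ n ih =>
    subst hn
    have IH : ∀ S' : Finset V, S'.card < S.card → ∀ D' : FlexSystem V i j, D'.Good S' →
        D'.Colorable S' := fun S' hS' D' hD' => ih _ hS' hD' rfl
    by_cases hx : ∃ x ∈ S, D.value x = i - j
    · obtain ⟨x, hx, hxv⟩ := hx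
      exact hS.colorable_of_tight hi hij IH hx hxv
    · push Not at hx
      exact hS.colorable_of_forall_not_tight hi hij IH hx

end FlexSystem

/-! ### Colouring sparse graphs -/

theorem sum_adj_eq_two_mul_ncard_edgeSet {V : Type*} [Fintype V] (K : SimpleGraph V)
    [DecidableRel K.Adj] :
    ∑ a, ∑ b, (if K.Adj a b then (1 : ℤ) else 0) = 2 * K.edgeSet.ncard := by
  classical
  have h := K.sum_degrees_eq_twice_card_edges
  have h1 : ∀ a, ∑ b, (if K.Adj a b then (1 : ℤ) else 0) = K.degree a := by
    intro a
    rw [Finset.sum_boole, SimpleGraph.degree, SimpleGraph.neighborFinset_eq_filter]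
  rw [Finset.sum_congr rfl fun a _ => h1 a, ← K.coe_edgeFinset, Set.ncard_coe_finset]
  exact_mod_cast h

theorem two_mul_ncard_edgeSet_le {V : Type*} [Fintype V] {G : SimpleGraph V}
    [DecidableRel G.Adj] (H : G.Subgraph) (A : Finset V) (hA : H.verts = A) :
    2 * (H.edgeSet.ncard : ℤ) ≤ ∑ a ∈ A, ∑ b ∈ A, if G.Adj a b then 1 else 0 := by
  classical
  rw [← H.edgeSet_spanningCoe, ← sum_adj_eq_two_mul_ncard_edgeSet, ← Finset.sum_subset
    (Finset.subset_univ A)]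
  · refine Finset.sum_le_sum fun a _ => ?_
    rw [← Finset.sum_subset (Finset.subset_univ A)]
    · refine Finset.sum_le_sum fun b _ => ?_
      have : H.spanningCoe.Adj a b → G.Adj a b := fun h => H.adj_sub h
      split_ifs <;> simp_all
    · intro b _ hb
      rw [if_neg]
      exact fun h => hb (by simpa [hA] using H.edge_vert (show H.Adj a b from h).symm)
  · intro a _ ha
    refine Finset.sum_eq_zero fun b _ => ?_
    rw [if_neg]
    exact fun h => ha (by simpa [hA] using H.edge_vert (show H.Adj a b from h))

theorem two_mul_ncard_edgeSet_induce {V : Type*} [Fintype V] (G : SimpleGraph V)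
    [DecidableRel G.Adj] (A : Finset V) :
    2 * ((((⊤ : G.Subgraph).induce (A : Set V)).edgeSet.ncard : ℕ) : ℤ) =
      ∑ a ∈ A, ∑ b ∈ A, if G.Adj a b then 1 else 0 := by
  classical
  rw [← SimpleGraph.Subgraph.edgeSet_spanningCoe, ← sum_adj_eq_two_mul_ncard_edgeSet]
  have h : ∀ a b, ((⊤ : G.Subgraph).induce (A : Set V)).spanningCoe.Adj a b ↔
      a ∈ A ∧ b ∈ A ∧ G.Adj a b := by
    intro a b; simp
  simp only [h, ite_and]
  simp

namespace DPCover

variable {V : Type u} {G : SimpleGraph V} {W : Type w}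

open Classical in
/-- The exclusive or of the colours of conflicting elements of the lists of `u` and `v`. It is
`false` if the matching joins poor to poor or rich to rich, and `true` otherwise; if the matching
is not perfect, the sign still describes a perfect matching that contains it. -/
noncomputable def sign (C : DPCover G W) (p r : V → W) (u v : V) : Bool :=
  !decide (C.H.Adj (p u) (p v) ∨ C.H.Adj (r u) (r v))

theorem sign_comm (C : DPCover G W) (p r : V → W) (u v : V) :
    C.sign p r u v = C.sign p r v u := by
  rw [sign, sign, C.H.adj_comm (p u), C.H.adj_comm (r u)]

theorem xor_eq_sign {C : DPCover G W} {p r : V → W} (h : C.IsPoorRich p r) {u v : V}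
    (huv : G.Adj u v) {a b : Bool}
    (hab : C.H.Adj (if a then r u else p u) (if b then r v else p v)) :
    (a ^^ b) = C.sign p r u v := by
  have hp : ∀ x, p x ∈ C.L x := fun x => by rw [(h x).2]; simp
  have hr : ∀ x, r x ∈ C.L x := fun x => by rw [(h x).2]; simp
  cases a <;> cases b <;> simp only [if_true, if_false, Bool.false_eq_true] at hab
  · simp [sign, hab]
  · simp only [sign, Bool.xor_true, Bool.not_false]
    rw [eq_comm, Bool.not_eq_true', decide_eq_false_iff_not]
    rintro (h1 | h1)
    · exact (h v).1 (C.matching u v huv _ (hp u) _ (hp v) _ (hr v) h1 hab)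
    · exact (h u).1 (C.matching v u huv.symm _ (hr v) _ (hp u) _ (hr u) hab.symm h1.symm)
  · simp only [sign, Bool.xor_false]
    rw [eq_comm, Bool.not_eq_true', decide_eq_false_iff_not]
    rintro (h1 | h1)
    · exact (h u).1 (C.matching v u huv.symm _ (hp v) _ (hp u) _ (hr u) h1.symm hab.symm)
    · exact (h v).1 (C.matching u v huv _ (hr u) _ (hp v) _ (hr v) hab h1)
  · simp [sign, hab]

open Classical in
/-- The system of a cover: full capacities, the edges of `G` as hard edges, no flexible edges. -/
noncomputable def toFlexSystem (C : DPCover G W) (p r : V → W) (i j : ℕ) : FlexSystem V i j where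
  cap _ b := if b then j else i
  hard u v b := if G.Adj u v ∧ C.sign p r u v = b then 1 else 0
  flex _ _ _ := 0
  hard_nonneg u v b := by split_ifs <;> norm_num
  flex_nonneg _ _ _ := le_rfl
  hard_symm u v b := by rw [C.sign_comm, G.adj_comm]
  flex_symm _ _ _ := rfl
  hard_self u b := by simp
  flex_self _ _ := rfl

open Classical in
theorem toFlexSystem_hardDeg (C : DPCover G W) (p r : V → W) (i j : ℕ) (u v : V) :
    (C.toFlexSystem p r i j).hardDeg u v = if G.Adj u v then 1 else 0 := by
  simp only [FlexSystem.hardDeg, toFlexSystem]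
  by_cases h : G.Adj u v <;> cases C.sign p r u v <;> simp [h]

theorem exists_isDefectiveColoring [Fintype V] [DecidableEq V] {C : DPCover G W} {p r : V → W}
    {i j : ℕ} (h : C.IsPoorRich p r)
    (hcol : (C.toFlexSystem p r i j).Colorable Finset.univ) :
    ∃ φ, C.IsDefectiveColoring p r i j φ := by
  classical
  obtain ⟨t, o, ho⟩ := hcol
  let φ : V → W := fun u => if t u then r u else p u
  have hp : ∀ x, p x ∈ C.L x := fun x => by rw [(h x).2]; simp
  have hr : ∀ x, r x ∈ C.L x := fun x => by rw [(h x).2]; simp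
  have hφL : ∀ x, φ x ∈ C.L x := by
    intro x; simp only [φ]; split_ifs; exacts [hr x, hp x]
  have hL : ∀ {x u v}, x ∈ C.L u → x ∈ C.L v → u = v := fun {x u v} hu hv =>
    (C.partition x).unique hu hv
  have hdeg : ∀ u, (((C.inducedCoverGraph φ).neighborSet ⟨φ u, u, rfl⟩).encard : ℕ∞) ≤
      ((if t u then j else i : ℕ) : ℕ∞) := by
    intro u
    have hle := ho.load_le u (Finset.mem_univ u)
    have h1 : ((Finset.univ.filter fun v => G.Adj u v ∧ C.sign p r u v = (t u ^^ t v)).card : ℤ) ≤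
        (if t u then j else i : ℕ) := by
      refine le_trans ?_ (hle.trans_eq ?_)
      · rw [FlexSystem.load, Finset.card_filter]
        push_cast
        refine Finset.sum_le_sum fun v _ => ?_
        have := ho.nonneg u v
        simp only [toFlexSystem]
        linarith
      · simp only [toFlexSystem]; split_ifs <;> rfl
    have h2 : (C.inducedCoverGraph φ).neighborSet ⟨φ u, u, rfl⟩ ⊆
        (fun v => (⟨φ v, v, rfl⟩ : Set.range φ)) ''
          ((Finset.univ.filter fun v => G.Adj u v ∧ C.sign p r u v = (t u ^^ t v) : Finset V) :
            Set V) := by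
      rintro ⟨_, v, rfl⟩ hv
      have hadj : C.H.Adj (φ u) (φ v) := hv
      refine ⟨v, ?_, rfl⟩
      have huv : G.Adj u v := by
        refine (C.eq_or_adj u v _ _ (hφL u) (hφL v) hadj).resolve_left ?_
        rintro rfl
        exact C.H.loopless.irrefl _ hadj
      simpa using ⟨huv, (xor_eq_sign h huv hadj).symm⟩
    refine (Set.encard_le_encard h2).trans ((Set.encard_image_le _ _).trans ?_)
    rw [Set.encard_coe_eq_coe_finsetCard]
    exact_mod_cast h1
  refine ⟨φ, ⟨fun u v huv => hL (hφL u) (huv ▸ hφL v), hφL⟩, ?_, ?_⟩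
  · rintro ⟨_, v, rfl⟩ u hx
    dsimp only at hx
    obtain rfl : u = v := hL (hp u) (hx ▸ hφL v)
    have ht : t u = false := by
      by_contra hc
      simp only [φ, Bool.not_eq_false] at hx hc
      rw [hc] at hx
      exact (h u).1 hx.symm
    simpa [ht] using hdeg u
  · rintro ⟨_, v, rfl⟩ u hx
    dsimp only at hx
    obtain rfl : u = v := hL (hr u) (hx ▸ hφL v)
    have ht : t u = true := by
      by_contra hc
      simp only [φ, Bool.not_eq_true] at hx hc
      rw [hc] at hx
      exact (h u).1 hx
    simpa [ht] using hdeg u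

end DPCover

theorem isDefectiveDPColorable_of_sparse {i j : ℕ} (hi : 2 ≤ i) (hj : 2 * i + 1 ≤ j)
    {V : Type u} [Finite V] (G : SimpleGraph V)
    (hG : ∀ H : G.Subgraph, ((i : ℤ) + 1) * H.edgeSet.ncard <
      (2 * i + 1) * H.verts.ncard + j - i + 1) : IsDefectiveDPColorable G i j := by
  classical
  have := Fintype.ofFinite V
  intro W C p r _ hpr
  refine DPCover.exists_isDefectiveColoring hpr (FlexSystem.Good.colorable (by omega) (by omega)
    ⟨fun v _ b => ?_, fun v _ => le_rfl, fun v _ => le_rfl, fun u _ v _ => ?_, fun A _ => ?_⟩)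
  · simp only [DPCover.toFlexSystem]; split_ifs <;> omega
  · rw [DPCover.toFlexSystem_hardDeg]; split_ifs <;> norm_num
  · have h1 := hG ((⊤ : G.Subgraph).induce (A : Set V))
    have h2 := two_mul_ncard_edgeSet_induce G A
    have h3 := (C.toFlexSystem p r i j).two_mul_surplus A
    have h4 : ∀ v, (C.toFlexSystem p r i j).value v = 2 * i + 1 := by
      intro v; simp [FlexSystem.value, DPCover.toFlexSystem]; ring
    have h5 : ∀ u v, (C.toFlexSystem p r i j).wt u v = (i + 1) * if G.Adj u v then 1 else 0 := by
      intro u v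
      rw [FlexSystem.wt, DPCover.toFlexSystem_hardDeg]
      simp [FlexSystem.flexDeg, DPCover.toFlexSystem]
    simp only [h4, h5, ← Finset.mul_sum, Finset.sum_sub_distrib, Finset.sum_const,
      nsmul_eq_mul] at h3
    rw [← h2] at h3
    rw [SimpleGraph.Subgraph.induce_verts, Set.ncard_coe_finset] at h1
    nlinarith

/-! ### Sharpness -/

/-- To refute colourability it suffices to give, by the relation `conf`, a sign to some of the edges of
`G` such that every choice of colours overloads a vertex. The cover is the one on `U × Bool` in
which the edge of sign `s` is the matching of colours with exclusive or `s`. -/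
theorem not_isDefectiveDPColorable_of_conflict {U : Type u} {G : SimpleGraph U} {i j : ℕ}
    (conf : U → U → Bool → Prop) (hsymm : ∀ a b s, conf a b s → conf b a s)
    (hadj : ∀ a b s, conf a b s → G.Adj a b)
    (huniq : ∀ a b s s', conf a b s → conf a b s' → s = s')
    (h : ∀ t : U → Bool, ∃ v,
      ((if t v then j else i : ℕ) : ℕ∞) < {w | conf v w (t v ^^ t w)}.encard) :
    ¬ IsDefectiveDPColorable G i j := by
  intro hcol
  let C : DPCover G (U × Bool) :=
    { L := fun u => {x | x.1 = u}
      H :=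
        { Adj := fun x y => (x.1 = y.1 ∧ x.2 ≠ y.2) ∨ conf x.1 y.1 (x.2 ^^ y.2)
          symm := ⟨by
            rintro x y (⟨h1, h2⟩ | h1)
            · exact Or.inl ⟨h1.symm, h2.symm⟩
            · exact Or.inr (by rw [Bool.xor_comm]; exact hsymm _ _ _ h1)⟩
          loopless := ⟨by
            rintro x (⟨-, h2⟩ | h1)
            · exact h2 rfl
            · exact G.loopless.irrefl _ (hadj _ _ _ h1)⟩ }
      partition := fun x => ⟨x.1, rfl, fun _ h => Eq.symm h⟩
      complete := by
        rintro u ⟨x, b⟩ hx ⟨y, c⟩ hy hne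
        obtain rfl : x = u := hx
        obtain rfl : y = x := hy
        exact Or.inl ⟨rfl, fun h => hne (by rw [show b = c from h])⟩
      eq_or_adj := by
        rintro u v x y rfl rfl (⟨h1, -⟩ | h1)
        · exact Or.inl h1
        · exact Or.inr (hadj _ _ _ h1)
      matching := by
        rintro u v huv ⟨x, b⟩ hx ⟨y, c⟩ hy ⟨y', c'⟩ hy' h1 h2
        obtain rfl : x = u := hx
        obtain rfl : y = v := hy
        obtain rfl : y' = y := hy'
        have hne : x ≠ y' := huv.ne
        have e := huniq _ _ _ _ (h1.resolve_left fun h => hne h.1)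
          (h2.resolve_left fun h => hne h.1)
        exact Prod.ext rfl (Bool.xor_right_inj.1 e) }
  obtain ⟨φ, ⟨hinj, hL⟩, hp, hr⟩ := hcol (U × Bool) C (fun u => (u, false)) (fun u => (u, true))
    (fun u => by
      have : C.L u = {(u, false), (u, true)} := by
        ext ⟨x, b⟩; cases b <;> simp [C]
      rw [this, Set.encard_pair (by simp)]; rfl)
    (fun u => ⟨by simp, by ext ⟨x, b⟩; cases b <;> simp [C]⟩)
  have hφ : ∀ u, (φ u).1 = u := hL
  obtain ⟨v, hv⟩ := h fun u => (φ u).2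
  have hle : {w | conf v w ((φ v).2 ^^ (φ w).2)}.encard ≤
      ((C.inducedCoverGraph φ).neighborSet ⟨φ v, v, rfl⟩).encard := by
    have hi : Function.Injective fun w => (⟨φ w, w, rfl⟩ : Set.range φ) := fun a b hab =>
      hinj (Subtype.ext_iff.1 hab)
    rw [← hi.encard_image]
    refine Set.encard_le_encard ?_
    rintro _ ⟨w, hw, rfl⟩
    refine (Or.inr ?_ : C.H.Adj (φ v) (φ w))
    rw [hφ, hφ]
    exact hw
  refine absurd (hv.trans_le hle) (not_lt.2 ?_)
  by_cases hb : (φ v).2 = true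
  · simpa [hb] using hr ⟨φ v, v, rfl⟩ v (Prod.ext (hφ v) hb)
  · simpa [hb] using hp ⟨φ v, v, rfl⟩ v (Prod.ext (hφ v) (by simpa using hb))

namespace SharpGraph

/-- The gadgets of the sharp graph: `j + 1` of them load the hub if it is rich, and `i + 1` if it is
poor. -/
abbrev Gadget (i j : ℕ) : Type := Fin (j + 1) ⊕ Fin (i + 1)

/-- The vertices of the sharp graph: a hub and, for every gadget, a cycle of `L` rim vertices, `i` link
vertices for each pair of consecutive rim vertices, and a tail vertex. -/
abbrev Vertex (i j L : ℕ) : Type :=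
  Unit ⊕ (Gadget i j × ZMod L) ⊕ (Gadget i j × ZMod L × Fin i) ⊕ Gadget i j

variable {i j L : ℕ}

abbrev hub : Vertex i j L := .inl ()
abbrev rim (q : Gadget i j) (k : ZMod L) : Vertex i j L := .inr (.inl (q, k))
abbrev link (q : Gadget i j) (k : ZMod L) (m : Fin i) : Vertex i j L :=
  .inr (.inr (.inl (q, k, m)))
abbrev tail (q : Gadget i j) : Vertex i j L := .inr (.inr (.inr q))

/-- The edges of the sharp graph, oriented towards the rim or the hub, with their signs: `none` if
there is no arc. All rim vertices are joined to the hub, a link to its two consecutive rim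
vertices, and the tail to the hub and to the rim vertex `0`. If the hub has the colour of the
gadget and bears no load from it, the signs force all rim vertices to be poor and make every link
load one of its two neighbours. -/
def arc : Vertex i j L → Vertex i j L → Option Bool
  | .inr (.inl (q, _)), .inl _ => some (!q.isLeft)
  | .inr (.inr (.inl (q, k, _))), .inr (.inl (q', k')) =>
      if q' = q then (if k' = k then some false else if k' = k + 1 then some true else none)
      else none
  | .inr (.inr (.inr q)), .inl _ => some (!q.isLeft)
  | .inr (.inr (.inr q)), .inr (.inl (q', k')) => if q' = q ∧ k' = 0 then some false else none
  | _, _ => none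

theorem arc_asymm (a b : Vertex i j L) : arc a b = none ∨ arc b a = none := by
  rcases a with a | a | a | a <;> rcases b with b | b | b | b <;> simp [arc]

/-- The sharp graph, on `1 + (i + j + 2) * (L + L * i + 1)` vertices. -/
def graph (i j L : ℕ) : SimpleGraph (Vertex i j L) where
  Adj a b := arc a b ≠ none ∨ arc b a ≠ none
  symm := ⟨fun _ _ h => h.symm⟩
  loopless := ⟨fun a h => by have := arc_asymm a a; tauto⟩

/-- The edge between `a` and `b` is present and has sign `s`. -/
def conflict (a b : Vertex i j L) (s : Bool) : Prop := arc a b = some s ∨ arc b a = some s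

theorem conflict_unique {a b : Vertex i j L} {s s' : Bool} (h : conflict a b s)
    (h' : conflict a b s') : s = s' := by
  rcases arc_asymm a b with h0 | h0 <;> simp_all [conflict]

/-- If no rim vertex is overloaded, every gadget of the colour of the hub loads the hub: otherwise
the `L * i` links and the tail load the `L` rim vertices, which are poor, `L * i + 1` times. -/
theorem exists_conflict [NeZero L] (hL : (1 : ZMod L) ≠ 0) (t : Vertex i j L → Bool)
    (hrim : ∀ q k, {w | conflict (rim q k) w (t (rim q k) ^^ t w)}.encard ≤
      ((if t (rim q k) then j else i : ℕ) : ℕ∞))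
    (q : Gadget i j) (hq : q.isLeft = t hub) :
    (∃ k, conflict hub (rim q k) (t hub ^^ t (rim q k))) ∨
      conflict (hub : Vertex i j L) (tail q) (t hub ^^ t (tail q)) := by
  by_contra hcon
  push Not at hcon
  obtain ⟨hy, hu⟩ := hcon
  have hy' : ∀ k, t (rim q k) = false := by
    intro k
    have := hy k
    simp only [conflict, arc, hq] at this
    revert this
    cases t hub <;> cases t (rim q k) <;> simp
  have hu' : t (tail q) = false := by
    simp only [conflict, arc, hq] at hu
    revert hu
    cases t hub <;> cases t (tail q) <;> simp
  -- every link loads one of its ends, and the tail loads `rim q 0`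
  let g : (ZMod L × Fin i) ⊕ Unit → ZMod L :=
    Sum.elim (fun km => if t (link q km.1 km.2) then km.1 + 1 else km.1) fun _ => 0
  obtain ⟨k, hk⟩ := Fintype.exists_lt_card_fiber_of_mul_lt_card g (n := i) (by simp)
  let f : (ZMod L × Fin i) ⊕ Unit → Vertex i j L :=
    Sum.elim (fun km => link q km.1 km.2) fun _ => tail q
  have hf : Function.Injective f := by
    rintro (⟨a, b⟩ | a) (⟨c, d⟩ | c) h <;> simp_all [f]
  have hsub : f '' {x | g x = k} ⊆ {w | conflict (rim q k) w (t (rim q k) ^^ t w)} := by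
    rintro _ ⟨(⟨k', m⟩ | _), hx, rfl⟩
    · right
      simp only [f, Sum.elim_inl, hy', Bool.false_xor]
      simp only [g, Set.mem_ofPred_eq, Sum.elim_inl] at hx
      cases h : t (link q k' m) <;> simp only [h, if_true, if_false, Bool.false_eq_true] at hx <;>
        subst hx <;> simp [arc, hL]
    · right
      simp only [g, Set.mem_ofPred_eq, Sum.elim_inr] at hx
      subst hx
      simp [f, arc, hy', hu']
  have h1 := (Set.encard_le_encard hsub).trans (hrim q k)
  rw [hf.encard_image, hy' k] at h1
  have h2 : ({x | g x = k} : Set _) = ((Finset.univ.filter fun x => g x = k : Finset _) : Set _) := by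
    ext; simp
  rw [h2, Set.encard_coe_eq_coe_finsetCard] at h1
  simp only [Bool.false_eq_true, if_false] at h1
  have h3 : (Finset.univ.filter fun x => g x = k).card ≤ i := by exact_mod_cast h1
  omega

theorem exists_overloaded [NeZero L] (hL : (1 : ZMod L) ≠ 0) (t : Vertex i j L → Bool) :
    ∃ v, ((if t v then j else i : ℕ) : ℕ∞) < {w | conflict v w (t v ^^ t w)}.encard := by
  by_contra hcon
  push Not at hcon
  have hex : ∀ q : Gadget i j, ∃ w : Vertex i j L, q.isLeft = t hub →
      conflict hub w (t hub ^^ t w) ∧ ((∃ k, w = rim q k) ∨ w = tail q) := by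
    intro q
    by_cases hq : q.isLeft = t hub
    · rcases exists_conflict hL t (fun q k => hcon _) q hq with ⟨k, hk⟩ | h
      · exact ⟨_, fun _ => ⟨hk, Or.inl ⟨k, rfl⟩⟩⟩
      · exact ⟨_, fun _ => ⟨h, Or.inr rfl⟩⟩
    · exact ⟨hub, fun h => absurd h hq⟩
  choose w hw using hex
  have hinj : ∀ q q', q.isLeft = t hub → q'.isLeft = t hub → w q = w q' → q = q' := by
    intro q q' hq hq' h
    rcases (hw q hq).2 with ⟨k, hk⟩ | hk <;> rcases (hw q' hq').2 with ⟨k', hk'⟩ | hk' <;>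
      simp_all
  have hle := hcon hub
  have key : ∀ (n : ℕ) (f : Fin (n + 1) → Gadget i j), Function.Injective f →
      (∀ x, (f x).isLeft = t hub) →
      ((n + 1 : ℕ) : ℕ∞) ≤ {w | conflict hub w (t hub ^^ t w)}.encard := by
    intro n f hf hft
    have h1 : Function.Injective (w ∘ f) := fun a b h => hf (hinj _ _ (hft a) (hft b) h)
    have h2 := h1.encard_image Set.univ
    rw [Set.encard_univ, ENat.card_eq_coe_fintype_card, Fintype.card_fin] at h2
    rw [← h2]
    refine Set.encard_le_encard ?_
    rintro _ ⟨x, -, rfl⟩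
    exact (hw _ (hft x)).1
  cases ht : t hub
  · have h1 := (key i Sum.inr Sum.inr_injective (by simp [ht])).trans hle
    rw [ht, if_neg (by simp)] at h1
    have h2 : i + 1 ≤ i := by exact_mod_cast h1
    omega
  · have h1 := (key j Sum.inl Sum.inl_injective (by simp [ht])).trans hle
    rw [ht, if_pos rfl] at h1
    have h2 : j + 1 ≤ j := by exact_mod_cast h1
    omega

end SharpGraph

namespace SharpGraph

variable {i j L : ℕ}

set_option synthInstance.maxSize 1000 in
instance : DecidableEq (Vertex i j L) := inferInstance

/-- The indicator of the arcs. -/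
def arcCount (a b : Vertex i j L) : ℤ := if arc a b = none then 0 else 1

theorem sum_adj_eq [NeZero L] (A : Finset (Vertex i j L)) [DecidableRel (graph i j L).Adj] :
    ∑ a ∈ A, ∑ b ∈ A, (if (graph i j L).Adj a b then (1 : ℤ) else 0) =
      2 * ∑ a ∈ A, ∑ b ∈ A, arcCount a b := by
  have h : ∀ a b : Vertex i j L, (if (graph i j L).Adj a b then (1 : ℤ) else 0) =
      arcCount a b + arcCount b a := by
    intro a b
    have h1 : (graph i j L).Adj a b ↔ arc a b ≠ none ∨ arc b a ≠ none := Iff.rfl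
    simp only [h1, arcCount]
    rcases arc_asymm a b with h0 | h0 <;> rw [h0]
    · by_cases h2 : arc b a = none <;> simp [h2]
    · by_cases h2 : arc a b = none <;> simp [h2]
  simp only [h, Finset.sum_add_distrib]
  rw [Finset.sum_comm (f := fun a b => arcCount b a)]
  ring

theorem sum_vertex [NeZero L] (f : Vertex i j L → ℤ) :
    ∑ a, f a = f hub + (∑ q, ∑ k, f (rim q k) + (∑ q, ∑ k, ∑ m, f (link q k m) +
      ∑ q, f (tail q))) := by
  rw [Fintype.sum_sum_type, Fintype.sum_sum_type, Fintype.sum_sum_type]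
  simp only [Fintype.sum_prod_type, Finset.univ_unique, Finset.sum_singleton]

/-- The contribution of a gadget to the potential of a vertex set, as a function of the indicators
of the set at the hub (`X`), the rim (`y`), the links (`z`) and the tail (`u`). -/
def balance (i : ℕ) [NeZero L] (X : ℤ) (y : ZMod L → ℤ) (z : ZMod L → Fin i → ℤ) (u : ℤ) : ℤ :=
  ∑ k, (((2 * i + 1) * y k - (i + 1) * (y k * X)) +
    ∑ m, ((2 * i + 1) * z k m - (i + 1) * (z k m * (y k + y (k + 1))))) +
    ((2 * i + 1) * u - (i + 1) * (u * (X + y 0)))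

theorem potential_eq [NeZero L] (hL : (1 : ZMod L) ≠ 0) (χ : Vertex i j L → ℤ) :
    (2 * i + 1) * ∑ a, χ a - (i + 1) * ∑ a, ∑ b, χ a * (χ b * arcCount a b) =
      (2 * i + 1) * χ hub + ∑ q, balance i (χ hub) (fun k => χ (rim q k))
        (fun k m => χ (link q k m)) (χ (tail q)) := by
  have e1 : ∀ q : Gadget i j, ∀ k, ∑ b, χ b * arcCount (rim q k) b = χ hub := by
    intro q k
    simp [Fintype.sum_sum_type, arcCount, arc]
  have e2 : ∀ q : Gadget i j, ∀ k m, ∑ b, χ b * arcCount (link q k m) b =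
      χ (rim q k) + χ (rim q (k + 1)) := by
    intro q k m
    have h : ∀ q' k', arcCount (link q k m) (rim q' k' : Vertex i j L) =
        if q' = q then ((if k' = k then 1 else 0) + if k' = k + 1 then 1 else 0) else 0 := by
      intro q' k'
      simp only [arcCount, arc]
      have hk : k ≠ k + 1 := by simpa using hL
      by_cases hq : q' = q
      · by_cases h1 : k' = k
        · subst h1; simp [hq, hk]
        · by_cases h2 : k' = k + 1
          · simp [hq, h2, hL]
          · simp [hq, h1, h2]
      · simp [hq]
    rw [sum_vertex]
    simp only [h]
    simp [arcCount, arc, mul_add, Finset.sum_add_distrib]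
  have e3 : ∀ q : Gadget i j, ∑ b, χ b * arcCount (tail q) b = χ hub + χ (rim q 0) := by
    intro q
    have h : ∀ q' k', arcCount (tail q) (rim q' k' : Vertex i j L) =
        if q' = q then (if k' = 0 then 1 else 0) else 0 := by
      intro q' k'
      simp only [arcCount, arc]
      by_cases hq : q' = q <;> by_cases h1 : k' = 0 <;> simp [hq, h1]
    rw [sum_vertex]
    simp only [h]
    simp [arcCount, arc]
  have e0 : ∑ b, χ b * arcCount (hub : Vertex i j L) b = 0 := by
    refine Finset.sum_eq_zero fun b _ => ?_
    rcases b with b | b | b | b <;> simp [arcCount, arc]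
  simp only [← Finset.mul_sum]
  rw [sum_vertex, sum_vertex (fun a => χ a * ∑ b, χ b * arcCount a b)]
  simp only [e0, e1, e2, e3, balance, Finset.sum_add_distrib, Finset.sum_sub_distrib,
    ← Finset.mul_sum]
  ring

section balance

variable {u : ℤ} {y : ZMod L → ℤ} {z : ZMod L → Fin i → ℤ}

/-- Only links with both ends in the set lower the potential, each by one. -/
theorem link_term_ge (hy : ∀ k, y k = 0 ∨ y k = 1) (hz : ∀ k m, z k m = 0 ∨ z k m = 1)
    (k : ZMod L) : -(i * (y k * y (k + 1))) ≤
      ∑ m, ((2 * i + 1) * z k m - (i + 1) * (z k m * (y k + y (k + 1)))) := by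
  have h : ∑ m : Fin i, -(y k * y (k + 1)) ≤
      ∑ m, ((2 * i + 1) * z k m - (i + 1) * (z k m * (y k + y (k + 1)))) := by
    refine Finset.sum_le_sum fun m _ => ?_
    have hi : (0 : ℤ) ≤ i := Int.natCast_nonneg i
    rcases hy k with h1 | h1 <;> rcases hy (k + 1) with h2 | h2 <;> rcases hz k m with h3 | h3 <;>
      rw [h1, h2, h3] <;> linarith
  simpa using h

theorem balance_nonneg_of_hub_eq_zero [NeZero L] (hy : ∀ k, y k = 0 ∨ y k = 1)
    (hz : ∀ k m, z k m = 0 ∨ z k m = 1) (hu : u = 0 ∨ u = 1) : 0 ≤ balance i 0 y z u := by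
  have hi : (0 : ℤ) ≤ i := Int.natCast_nonneg i
  refine add_nonneg (Finset.sum_nonneg fun k _ => ?_) ?_
  · have h := link_term_ge hy hz k
    rcases hy k with h1 | h1 <;> rcases hy (k + 1) with h2 | h2 <;>
      rw [h1, h2] at h ⊢ <;> linarith
  · rcases hu with h1 | h1 <;> rcases hy 0 with h2 | h2 <;> rw [h1, h2] <;> linarith

/-- A gadget contributes at least `-1`, and less than `0` only if it is contained in the set: the
part of the rim in a set that contains the hub and the tail is otherwise not closed under the
successor. -/
theorem neg_one_le_balance [NeZero L] (hi : 1 ≤ i) (hy : ∀ k, y k = 0 ∨ y k = 1)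
    (hz : ∀ k m, z k m = 0 ∨ z k m = 1) (hu : u = 0 ∨ u = 1) :
    -1 ≤ balance i 1 y z u ∧
      (balance i 1 y z u < 0 → (∀ k, y k = 1) ∧ (∀ k m, z k m = 1) ∧ u = 1) := by
  have hi' : (1 : ℤ) ≤ i := by exact_mod_cast hi
  set T : ZMod L → ℤ := fun k => ((2 * i + 1) * y k - (i + 1) * (y k * 1)) +
    ∑ m, ((2 * i + 1) * z k m - (i + 1) * (z k m * (y k + y (k + 1)))) with hT
  have hbal : balance i 1 y z u =
      ∑ k, T k + ((2 * i + 1) * u - (i + 1) * (u * (1 + y 0))) := rfl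
  have hTge : ∀ k, i * (y k * (1 - y (k + 1))) ≤ T k := by
    intro k
    have h := link_term_ge hy hz k
    simp only [hT]
    linarith
  have hT0 : ∀ k, 0 ≤ T k := by
    intro k
    refine le_trans ?_ (hTge k)
    rcases hy k with h1 | h1 <;> rcases hy (k + 1) with h2 | h2 <;> rw [h1, h2] <;> linarith
  have hsum : 0 ≤ ∑ k, T k := Finset.sum_nonneg fun k _ => hT0 k
  refine ⟨?_, fun hneg => ?_⟩
  · rw [hbal]
    rcases hu with h1 | h1 <;> rcases hy 0 with h2 | h2 <;> rw [h1, h2] <;> linarith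
  · rw [hbal] at hneg
    have hu1 : u = 1 := by
      refine hu.resolve_left fun h => ?_
      rw [h] at hneg; linarith
    have hy0 : y 0 = 1 := by
      refine (hy 0).resolve_left fun h => ?_
      rw [h, hu1] at hneg; linarith
    have hTz : ∀ k, T k = 0 := by
      rw [hu1, hy0] at hneg
      have h := (Finset.sum_eq_zero_iff_of_nonneg fun k _ => hT0 k).1
        (show ∑ k, T k = 0 by linarith)
      exact fun k => h k (Finset.mem_univ k)
    have hstep : ∀ k, y k = 1 → y (k + 1) = 1 := by
      intro k hk
      refine (hy (k + 1)).resolve_left fun h => ?_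
      have := hTge k
      rw [hk, h, hTz k] at this
      linarith
    have hy1 : ∀ k, y k = 1 := by
      have h : ∀ n : ℕ, y (n : ZMod L) = 1 := by
        intro n
        induction n with
        | zero => simpa using hy0
        | succ n ih => rw [Nat.cast_succ]; exact hstep _ ih
      intro k
      rw [← ZMod.natCast_zmod_val k]
      exact h _
    refine ⟨hy1, fun k => ?_, hu1⟩
    have h1 : T k = ∑ m, (1 - z k m) := by
      have h2 : ∀ m, ((2 * i + 1) * z k m - (i + 1) * (z k m * (1 + 1)) : ℤ) = - z k m :=
        fun m => by ring
      simp only [hT, hy1, h2]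
      simp only [Finset.sum_sub_distrib, Finset.sum_neg_distrib, Finset.sum_const,
        Finset.card_univ, Fintype.card_fin, nsmul_eq_mul]
      ring
    have h2 : ∀ m, 0 ≤ 1 - z k m := fun m => by rcases hz k m with h | h <;> rw [h] <;> norm_num
    have h3 := (Finset.sum_eq_zero_iff_of_nonneg fun m _ => h2 m).1 (h1.symm.trans (hTz k))
    intro m
    have := h3 m (Finset.mem_univ m)
    linarith

theorem balance_one [NeZero L] : balance i (L := L) 1 (fun _ => 1) (fun _ _ => 1) 1 = -1 := by
  simp [balance]
  ring

end balance

theorem potential_eq_sum [NeZero L] (hL : (1 : ZMod L) ≠ 0) (A : Finset (Vertex i j L)) :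
    (2 * i + 1) * (A.card : ℤ) - (i + 1) * ∑ a ∈ A, ∑ b ∈ A, arcCount a b =
      (2 * i + 1) * (if hub ∈ A then 1 else 0) + ∑ q, balance i (if hub ∈ A then 1 else 0)
        (fun k => if rim q k ∈ A then 1 else 0) (fun k m => if link q k m ∈ A then 1 else 0)
        (if tail q ∈ A then 1 else 0) := by
  rw [← potential_eq hL fun a => if a ∈ A then 1 else 0]
  simp [Finset.sum_ite_mem]

theorem card_gadget (i j : ℕ) : ∑ _q : Gadget i j, (-1 : ℤ) = -(i + j + 2) := by
  simp; ring

theorem potential_univ [NeZero L] (hL : (1 : ZMod L) ≠ 0) :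
    (2 * i + 1) * (Fintype.card (Vertex i j L) : ℤ) -
      (i + 1) * ∑ a : Vertex i j L, ∑ b, arcCount a b = i - j - 1 := by
  rw [← Finset.card_univ, potential_eq_sum hL]
  simp only [Finset.mem_univ, if_true, balance_one, card_gadget]
  ring

theorem potential_ge [NeZero L] (hL : (1 : ZMod L) ≠ 0) (hi : 1 ≤ i) (hij : i ≤ j)
    {A : Finset (Vertex i j L)} (hA : A ≠ Finset.univ) :
    (i : ℤ) - j ≤ (2 * i + 1) * (A.card : ℤ) - (i + 1) * ∑ a ∈ A, ∑ b ∈ A, arcCount a b := by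
  rw [potential_eq_sum hL]
  have h01 : ∀ a, (if a ∈ A then (1 : ℤ) else 0) = 0 ∨ (if a ∈ A then (1 : ℤ) else 0) = 1 := by
    intro a; split_ifs <;> simp
  by_cases hub_mem : hub ∈ A
  · simp only [hub_mem, if_true]
    have hb := fun q => neg_one_le_balance hi (fun k => h01 (rim q k))
      (fun k m => h01 (link q k m)) (h01 (tail q))
    by_cases hall : ∀ q, balance i 1 (fun k => if rim q k ∈ A then 1 else 0)
        (fun k m => if link q k m ∈ A then 1 else 0) (if tail q ∈ A then 1 else 0) < 0
    · refine absurd (Finset.eq_univ_of_forall fun a => ?_) hA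
      have hone : ∀ a, (if a ∈ A then (1 : ℤ) else 0) = 1 → a ∈ A := by
        intro a h
        by_contra hc
        rw [if_neg hc] at h
        exact zero_ne_one h
      rcases a with _ | ⟨q, k⟩ | ⟨q, k, m⟩ | q
      · exact hub_mem
      · exact hone _ (((hb q).2 (hall q)).1 k)
      · exact hone _ (((hb q).2 (hall q)).2.1 k m)
      · exact hone _ ((hb q).2 (hall q)).2.2
    · push Not at hall
      obtain ⟨q, hq⟩ := hall
      have := Finset.sum_lt_sum (fun q _ => (hb q).1)
        ⟨q, Finset.mem_univ q, lt_of_lt_of_le (by norm_num) hq⟩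
      rw [card_gadget] at this
      linarith
  · simp only [hub_mem, if_false]
    have := Finset.sum_nonneg fun q (_ : q ∈ (Finset.univ : Finset (Gadget i j))) =>
      balance_nonneg_of_hub_eq_zero (fun k => h01 (rim q k))
        (fun k m => h01 (link q k m)) (h01 (tail q))
    have : (i : ℤ) ≤ j := by exact_mod_cast hij
    linarith

end SharpGraph

open Classical in
theorem exists_sharp_graph {i j : ℕ} (hi : 1 ≤ i) (hij : i ≤ j) (N : ℕ) :
    ∃ n : ℕ, N ≤ n ∧ ∃ G : SimpleGraph (Fin n), ¬ IsDefectiveDPColorable G i j ∧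
      ((i : ℤ) + 1) * G.edgeSet.ncard = (2 * i + 1) * n + j - i + 1 ∧
      ∀ H : G.Subgraph, H ≠ ⊤ →
        ((i : ℤ) + 1) * H.edgeSet.ncard < (2 * i + 1) * H.verts.ncard + j - i + 1 := by
  have hL : (1 : ZMod (N + 2)) ≠ 0 := by
    have : Fact (1 < N + 2) := ⟨by omega⟩
    exact one_ne_zero
  let V := SharpGraph.Vertex i j (N + 2)
  let e : Fin (Fintype.card V) ≃ V := (Fintype.equivFin V).symm
  let G : SimpleGraph (Fin (Fintype.card V)) := (SharpGraph.graph i j (N + 2)).comap e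
  have hsum : ∀ A : Finset (Fin (Fintype.card V)),
      ∑ a ∈ A, ∑ b ∈ A, (if G.Adj a b then (1 : ℤ) else 0) =
        2 * ∑ a ∈ A.map e.toEmbedding, ∑ b ∈ A.map e.toEmbedding, SharpGraph.arcCount a b := by
    intro A
    rw [← SharpGraph.sum_adj_eq, Finset.sum_map]
    simp only [Finset.sum_map]
    rfl
  have hG : ((i : ℤ) + 1) * G.edgeSet.ncard = (2 * i + 1) * Fintype.card V + j - i + 1 := by
    have h1 := hsum Finset.univ
    rw [sum_adj_eq_two_mul_ncard_edgeSet, Finset.map_univ_equiv] at h1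
    have h2 := SharpGraph.potential_univ (i := i) (j := j) hL
    have h3 : (G.edgeSet.ncard : ℤ) =
        ∑ a : V, ∑ b : V, SharpGraph.arcCount a b := by linarith
    rw [h3]
    linarith
  refine ⟨Fintype.card V, ?_, G, ?_, hG, fun H hH => ?_⟩
  · have h1 := Fintype.card_le_of_injective (SharpGraph.rim (i := i) (j := j) (L := N + 2)
      (Sum.inl 0)) (fun a b h => by simpa using h)
    rw [ZMod.card] at h1
    exact le_trans (by omega) h1
  · refine not_isDefectiveDPColorable_of_conflict
      (fun a b s => SharpGraph.conflict (e a) (e b) s) (fun a b s h => Or.symm h)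
      (fun a b s h => ?_) (fun a b s s' h h' => SharpGraph.conflict_unique h h') (fun t => ?_)
    · refine Or.imp (fun h => ?_) (fun h => ?_) h <;> rw [h] <;> simp
    · obtain ⟨v, hv⟩ := SharpGraph.exists_overloaded hL (t ∘ e.symm)
      refine ⟨e.symm v, hv.trans_le ?_⟩
      rw [← e.symm.injective.encard_image]
      refine Set.encard_le_encard ?_
      rintro _ ⟨w, hw, rfl⟩
      simpa using! hw
  · by_cases hv : H.verts = Set.univ
    · have hlt : H.edgeSet.ncard < G.edgeSet.ncard := by
        refine Set.ncard_lt_ncard (H.edgeSet_subset.ssubset_of_ne fun heq => hH ?_)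
        refine SimpleGraph.Subgraph.ext hv ?_
        ext a b
        rw [← SimpleGraph.Subgraph.mem_edgeSet, heq, SimpleGraph.mem_edgeSet,
          SimpleGraph.Subgraph.top_adj]
      rw [hv, Set.ncard_univ, Nat.card_fin, ← hG]
      have : (H.edgeSet.ncard : ℤ) < G.edgeSet.ncard := by exact_mod_cast hlt
      nlinarith
    · have hA : H.verts = (H.verts.toFinset : Finset _) := by simp
      have h1 := two_mul_ncard_edgeSet_le H _ hA
      rw [hsum] at h1
      have h2 := SharpGraph.potential_ge hL hi hij
        (A := H.verts.toFinset.map e.toEmbedding) (fun h => hv (by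
          have h3 := (Finset.map_univ_equiv e).symm ▸ h
          have h4 := Finset.map_injective _ h3
          rw [hA, h4, Finset.coe_univ]))
      rw [Finset.card_map, ← Set.ncard_eq_toFinset_card'] at h2
      nlinarith

theorem mainTheorem4 (i j : ℕ) (hi : 3 ≤ i) (hj : 2 * i + 1 ≤ j) :
    (∀ (V : Type u) [Finite V] (G : SimpleGraph V),
      (∀ H : G.Subgraph,
        (H.edgeSet.ncard : ℝ) <
          ((2 * (i : ℝ) + 1) * (H.verts.ncard : ℝ) + (j : ℝ) - (i : ℝ) + 1) / ((i : ℝ) + 1)) →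
      IsDefectiveDPColorable G i j) ∧
    (∀ N : ℕ, ∃ n : ℕ, N ≤ n ∧ ∃ G : SimpleGraph (Fin n),
      ¬ IsDefectiveDPColorable G i j ∧
      (G.edgeSet.ncard : ℝ) =
        ((2 * (i : ℝ) + 1) * (n : ℝ) + (j : ℝ) - (i : ℝ) + 1) / ((i : ℝ) + 1) ∧
      ∀ H : G.Subgraph, H ≠ ⊤ →
        (H.edgeSet.ncard : ℝ) <
          ((2 * (i : ℝ) + 1) * (H.verts.ncard : ℝ) + (j : ℝ) - (i : ℝ) + 1) /
            ((i : ℝ) + 1)) := by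
  have hpos : (0 : ℝ) < (i : ℝ) + 1 := by positivity
  have hlt : ∀ m n : ℕ, (m : ℝ) < ((2 * (i : ℝ) + 1) * (n : ℝ) + (j : ℝ) - (i : ℝ) + 1) /
      ((i : ℝ) + 1) ↔ ((i : ℤ) + 1) * m < (2 * i + 1) * n + j - i + 1 := by
    intro m n
    rw [lt_div_iff₀ hpos, mul_comm, ← @Int.cast_lt ℝ]
    push_cast
    rfl
  refine ⟨fun V _ G hG => isDefectiveDPColorable_of_sparse (by omega) hj G
    fun H => (hlt _ _).1 (hG H), fun N => ?_⟩
  obtain ⟨n, hn, G, hcol, hedge, hsub⟩ :=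
    exists_sharp_graph (by omega : 1 ≤ i) (by omega : i ≤ j) N
  refine ⟨n, hn, G, hcol, ?_, fun H hH => (hlt _ _).2 (hsub H hH)⟩
  rw [eq_div_iff hpos.ne', mul_comm]
  exact_mod_cast hedge
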